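/- Conventions. A standard Lebesgue space is a non-atomic probability space isomorphic modulo null sets to $[0,1]$ with Lebesgue measure; a transformation $T$ of it is a measure-preserving map with a measure-preserving almost everywhere inverse; relations between sets are understood modulo null sets. An isomorphism of two systems is a measure-preserving map that intertwines them almost everywhere and has a measure-preserving almost everywhere inverse. $T$ is rank-one if there are integers $r_n>1$ ($n\in\mathbb N=\{0,1,\dots\}$) and $s_{n,i}\ge 0$ ($0<i\le r_n$) such that, with $h_0=1$ and $h_{n+1}=r_nh_n+\sum_{0<i\le r_n}s_{n,i}$, one has $\sum_n (h_{n+1}-r_nh_n)/h_{n+1}<\infty$, and there are measurable sets $B_n$, $B_{n,i}$ ($0<i\le r_n$), $C_{n,i,j}$ ($0<i\le r_n$, $0<j\le s_{n,i}$) such that for all $n$: $\{B_{n,i}\}_{0<i\le r_n}$ is a partition of $B_n$; the levels $T^i(B_n)$, $0\le i<h_n$, are disjoint; $T^{h_n}(B_{n,i})=C_{n,i,1}$ if $s_{n,i}\ne0$; $T^{h_n}(B_{n,i})=B_{n,i+1}$ if $s_{n,i}=0$ and $i<r_n$; $T(C_{n,i,j})=C_{n,i,j+1}$ if $j<s_{n,i}$;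 $T(C_{n,i,s_{n,i}})=B_{n,i+1}$ if $s_{n,i}\neq 0$ and $i<r_n$; $B_{n+1}=B_{n,1}$; and every measurable set is approximated arbitrarily well in measure by unions of levels of some stage-$n$ tower $\{T^i(B_n):0\le i<h_n\}$. Put $I_{m,n}=\{i: 0\le i<h_n,\ T^i(B_n)\subseteq B_m\}$, and let $[i]_k\in\{0,\dots,k-1\}$ denote the residue of $i$ modulo $k$. For integers $k_n>1$ with $k_n\mid k_{n+1}$ for all $n\in\mathbb N$, the odometer of $(k_n)$ is the space of sequences $(\alpha_n)$ with $\alpha_n\in\{0,\dots,k_n-1\}$ and $[\alpha_n]_{k_m}=\alpha_m$ for $m\le n$, with the probability measure giving $\{\alpha_n=i\}$ measure $1/k_n$ for $0\le i<k_n$, and the map $(\alpha_n)\mapsto([\alpha_n+1]_{k_n})$. Its set of divisors is $\bigcup_n\{d: d\mid k_n\}$. Theorem. Let $(X,\mu)$ be a standard Lebesgue space and $T$ a rank-one transformation of it, with a construction as above. The following are equivalent. (I) $T$ is isomorphic to an odometer. (II) For all $l\in\mathbb N$ and $\epsilon>0$ there is an integer $k>1$ such that for all $\eta>0$ there is $N\in\mathbb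 N$ such that for all $n>m\ge N$: (IIa) there is $j\in\{0,\dots,k-1\}$ with $\dfrac{|\{i\in I_{m,n}:[i]_k\ne j\}|}{|I_{m,n}|}<\eta$, and (IIb) there is $D\subseteq\{0,\dots,k-1\}$ with $\dfrac{|\{0\le i\le h_m:[i]_k\in D\}\,\Delta\, I_{l,m}|}{|I_{l,m}|}<\epsilon$. Moreover, if for every $l\in\mathbb N$ and $\epsilon>0$ an integer $k_{l,\epsilon}>1$ as in (II) is chosen, then the set $K$ of all divisors of the numbers $k_{l,\epsilon}$ is infinite, it is the set of divisors of some odometer, and $T$ is isomorphic to every odometer whose set of divisors is $K$. -/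

import Mathlib

open MeasureTheory Set

/-! ### Measure-preserving maps and isomorphisms modulo null sets -/

/-- `φ` is measure-preserving: preimages of measurable sets are measurable (for the completed
measure, so that only the values of `φ` on a set of full measure matter) and have the same
measure. -/
def IsMeasurePreservingMod0 {X Y : Type*} [MeasurableSpace X] [MeasurableSpace Y]
    (μ : Measure X) (ν : Measure Y) (φ : X → Y) : Prop :=
  ∀ A : Set Y, MeasurableSet A → NullMeasurableSet (φ ⁻¹' A) μ ∧ μ (φ ⁻¹' A) = ν A

/-- `φ` and `ψ` are measure-preserving maps that are inverse to each other almost everywhere. -/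
structure IsInvertibleMod0 {X Y : Type*} [MeasurableSpace X] [MeasurableSpace Y]
    (μ : Measure X) (ν : Measure Y) (φ : X → Y) (ψ : Y → X) : Prop where
  map_preserving : IsMeasurePreservingMod0 μ ν φ
  inv_preserving : IsMeasurePreservingMod0 ν μ ψ
  left_inv : ∀ᵐ x ∂μ, ψ (φ x) = x
  right_inv : ∀ᵐ y ∂ν, φ (ψ y) = y

/-- A standard Lebesgue space (non-atomic, of total measure one): a measure space that is
isomorphic modulo null sets to the unit interval with Lebesgue measure. -/
def IsStandardLebesgue {X : Type*} [MeasurableSpace X] (μ : Measure X) : Prop :=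
  ∃ (φ : X → ℝ) (ψ : ℝ → X), IsInvertibleMod0 μ (volume.restrict (Icc (0 : ℝ) 1)) φ ψ

/-- An invertible measure-preserving transformation of `(X, μ)`, with a choice `invFun` of its
almost everywhere defined inverse. -/
structure Transformation {X : Type*} [MeasurableSpace X] (μ : Measure X) where
  toFun : X → X
  invFun : X → X
  invertible : IsInvertibleMod0 μ μ toFun invFun

/-- The image `T ^ k (A)`, written as the preimage of `A` under the `k`-th iterate of the inverse.
(For maps that are invertible only almost everywhere this is the image modulo null sets, while the
literal image could be enlarged by the values of `T` on a null set.) -/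
def Transformation.image {X : Type*} [MeasurableSpace X] {μ : Measure X} (T : Transformation μ)
    (k : ℕ) (A : Set X) : Set X :=
  (T.invFun^[k]) ⁻¹' A

/-- The systems `(X, μ, T)` and `(Y, ν, S)` are isomorphic. -/
def AreIsomorphic {X Y : Type*} [MeasurableSpace X] [MeasurableSpace Y]
    (μ : Measure X) (T : X → X) (ν : Measure Y) (S : Y → Y) : Prop :=
  ∃ (φ : X → Y) (ψ : Y → X), IsInvertibleMod0 μ ν φ ψ ∧ ∀ᵐ x ∂μ, φ (T x) = S (φ x)

/-! ### Rank-one transformations -/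

/-- The heights `h 0 = 1`, `h (n + 1) = r n * h n + ∑_{0 < i ≤ r n} s n i`. -/
def towerHeight (r : ℕ → ℕ) (s : ℕ → ℕ → ℕ) : ℕ → ℕ
  | 0 => 1
  | n + 1 => r n * towerHeight r s n + ∑ i ∈ Finset.Icc 1 (r n), s n i

/-- A cutting and stacking construction of `T`, with cutting parameter `r` and spacer parameter
`s`; `T` is rank-one if it has one. The sets `B' n i` (the `i`-th piece of the base `B n`) are
relevant for `0 < i ≤ r n`, the spacers `C n i j` for `0 < i ≤ r n`, `0 < j ≤ s n i`.
Relations between sets are understood modulo null sets. -/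
structure RankOneConstruction {X : Type*} [MeasurableSpace X] {μ : Measure X}
    (T : Transformation μ) where
  r : ℕ → ℕ
  s : ℕ → ℕ → ℕ
  one_lt_r : ∀ n, 1 < r n
  summable_spacers : Summable fun n : ℕ =>
    ((towerHeight r s (n + 1) : ℝ) - r n * towerHeight r s n) / towerHeight r s (n + 1)
  B : ℕ → Set X
  B' : ℕ → ℕ → Set X
  C : ℕ → ℕ → ℕ → Set X
  measurable_B : ∀ n, NullMeasurableSet (B n) μ
  measurable_B' : ∀ n i, 0 < i → i ≤ r n → NullMeasurableSet (B' n i) μ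
  measurable_C : ∀ n i j, 0 < i → i ≤ r n → 0 < j → j ≤ s n i → NullMeasurableSet (C n i j) μ
  pieces_disjoint : ∀ n i j, 0 < i → i ≤ r n → 0 < j → j ≤ r n → i ≠ j →
    AEDisjoint μ (B' n i) (B' n j)
  pieces_union : ∀ n, (⋃ i ∈ Finset.Icc 1 (r n), B' n i) =ᵐ[μ] B n
  levels_disjoint : ∀ n i j, i < towerHeight r s n → j < towerHeight r s n → i ≠ j →
    AEDisjoint μ (T.image i (B n)) (T.image j (B n))
  top_to_spacer : ∀ n i, 0 < i → i ≤ r n → s n i ≠ 0 →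
    T.image (towerHeight r s n) (B' n i) =ᵐ[μ] C n i 1
  top_to_piece : ∀ n i, 0 < i → i < r n → s n i = 0 →
    T.image (towerHeight r s n) (B' n i) =ᵐ[μ] B' n (i + 1)
  spacer_to_spacer : ∀ n i j, 0 < i → i ≤ r n → 0 < j → j < s n i →
    T.image 1 (C n i j) =ᵐ[μ] C n i (j + 1)
  spacer_to_piece : ∀ n i, 0 < i → i < r n → s n i ≠ 0 →
    T.image 1 (C n i (s n i)) =ᵐ[μ] B' n (i + 1)
  base_succ : ∀ n, B (n + 1) =ᵐ[μ] B' n 1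
  dense : ∀ A : Set X, MeasurableSet A → ∀ ε : ENNReal, 0 < ε →
    ∃ (n : ℕ) (D : Finset ℕ), D ⊆ Finset.range (towerHeight r s n) ∧
      μ (symmDiff A (⋃ i ∈ D, T.image i (B n))) < ε

namespace RankOneConstruction

variable {X : Type*} [MeasurableSpace X] {μ : Measure X} {T : Transformation μ}

/-- The height of the stage-`n` tower. -/
def h (R : RankOneConstruction T) (n : ℕ) : ℕ := towerHeight R.r R.s n

open Classical in
/-- `I_{m,n}`: the indices of the levels of the stage-`n` tower that are contained in the base of
the stage-`m` tower. -/
noncomputable def I (R : RankOneConstruction T) (m n : ℕ) : Finset ℕ :=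
  (Finset.range (R.h n)).filter fun i => T.image i (R.B n) ≤ᵐ[μ] R.B m

/-- The combinatorial condition on `k`, for given `l` and `ε`: for every `η > 0`, for all
sufficiently large `m < n`, all but a proportion `η` of `I_{m,n}` lies in one residue class
modulo `k`, and `I_{l,m}` is `ε`-approximated by a union of residue classes modulo `k`. -/
def ResidueCondition (R : RankOneConstruction T) (l : ℕ) (ε : ℝ) (k : ℕ) : Prop :=
  ∀ η : ℝ, 0 < η → ∃ N : ℕ, ∀ m n : ℕ, N ≤ m → m < n →
    (∃ j < k, (((R.I m n).filter fun i => i % k ≠ j).card : ℝ) / (R.I m n).card < η) ∧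
    (∃ D ⊆ Finset.range k,
      ((symmDiff ((Finset.range (R.h m + 1)).filter fun i => i % k ∈ D) (R.I l m)).card : ℝ)
        / (R.I l m).card < ε)

end RankOneConstruction

/-! ### Odometers -/

/-- A sequence of integers greater than one, each dividing the next. -/
structure OdometerSeq where
  k : ℕ → ℕ
  one_lt : ∀ n, 1 < k n
  dvd_succ : ∀ n, k n ∣ k (n + 1)

namespace OdometerSeq

variable (O : OdometerSeq)

theorem dvd_of_le {m n : ℕ} (h : m ≤ n) : O.k m ∣ O.k n :=
  Nat.le_induction dvd_rfl (fun i _ ih => ih.trans (O.dvd_succ i)) n h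

theorem k_pos (n : ℕ) : 0 < O.k n := lt_trans Nat.zero_lt_one (O.one_lt n)

/-- The set of all divisors of the terms of the sequence. -/
def divisorSet : Set ℕ := {d | ∃ n, d ∣ O.k n}

/-- The underlying space: coherent sequences of residues, `α n ∈ {0, …, k n - 1}`. Its
σ-algebra is the one generated by the coordinates. -/
abbrev Space : Type :=
  {α : ℕ → ℕ // (∀ n, α n < O.k n) ∧ ∀ m n, m ≤ n → α n % O.k m = α m}

/-- The odometer map: add one in each coordinate. -/
def shift (α : O.Space) : O.Space :=
  ⟨fun n => (α.1 n + 1) % O.k n, fun n => Nat.mod_lt _ (O.k_pos n), fun m n hmn => by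
    rw [Nat.mod_mod_of_dvd _ (O.dvd_of_le hmn), Nat.add_mod, α.2.2 m n hmn, ← Nat.add_mod_mod]
    simp⟩

/-- The place values `1, k 0, k 1, …` of the digits. -/
def base : ℕ → ℕ
  | 0 => 1
  | n + 1 => O.k n

/-- The number of values of the `n`-th digit. -/
def radix (n : ℕ) : ℕ := O.k n / O.base n

theorem base_dvd (n : ℕ) : O.base n ∣ O.k n := by
  cases n with
  | zero => exact one_dvd _
  | succ n => exact O.dvd_succ n

theorem base_pos (n : ℕ) : 0 < O.base n := Nat.pos_of_dvd_of_pos (O.base_dvd n) (O.k_pos n)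

theorem base_mul_radix (n : ℕ) : O.base n * O.radix n = O.k n :=
  Nat.mul_div_cancel' (O.base_dvd n)

theorem radix_pos (n : ℕ) : 0 < O.radix n :=
  Nat.div_pos (Nat.le_of_dvd (O.k_pos n) (O.base_dvd n)) (O.base_pos n)

/-- The law of the `n`-th digit: uniform on `{0, …, radix n - 1}`. -/
noncomputable def digitLaw (n : ℕ) : Measure ℕ :=
  (PMF.uniformOfFinset (Finset.range (O.radix n))
    (Finset.nonempty_range_iff.2 (O.radix_pos n).ne')).toMeasure

instance (n : ℕ) : IsProbabilityMeasure (O.digitLaw n) := by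
  unfold digitLaw; infer_instance

/-- The number with digits `ω 0, …, ω n`. -/
def value (ω : ℕ → ℕ) (n : ℕ) : ℕ := ∑ j ∈ Finset.range (n + 1), ω j * O.base j

/-- The point of the odometer with the digits `ω`. -/
def ofDigits (ω : ℕ → ℕ) : O.Space :=
  ⟨fun n => O.value ω n % O.k n, fun n => Nat.mod_lt _ (O.k_pos n), fun m n hmn => by
    rw [Nat.mod_mod_of_dvd _ (O.dvd_of_le hmn)]
    induction n, hmn using Nat.le_induction with
    | base => rfl
    | succ n hmn ih =>
      have hd : ω (n + 1) * O.base (n + 1) % O.k m = 0 :=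
        Nat.mod_eq_zero_of_dvd ((O.dvd_of_le hmn).mul_left _)
      rw [← ih, value, Finset.sum_range_succ, ← value, Nat.add_mod, hd]
      simp⟩

/-- The natural measure of the odometer: the distribution of a point with independent, uniformly
distributed digits. It is the one with `{α | α n = i}` of measure `1 / k n`, see
`measure_cylinder`. -/
noncomputable def measure : Measure O.Space :=
  (Measure.infinitePi O.digitLaw).map O.ofDigits

theorem measurable_ofDigits : Measurable O.ofDigits := by
  refine Measurable.subtype_mk (measurable_pi_lambda _ fun n => ?_)
  have h : Measurable fun ω : ℕ → ℕ => O.value ω n :=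
    Finset.measurable_sum _ fun j _ => (measurable_pi_apply j).mul_const _
  exact (measurable_of_countable fun x : ℕ => x % O.k n).comp h

/-- The `j`-th digit of `x`. -/
def digit (x j : ℕ) : ℕ := x / O.base j % O.radix j

theorem value_digit (x n : ℕ) : O.value (O.digit x) n = x % O.k n := by
  induction n with
  | zero => simp [value, digit, base, radix]
  | succ n ih =>
    rw [value, Finset.sum_range_succ, ← value, ih, ← O.base_mul_radix (n + 1)]
    simp only [digit, base]
    rw [Nat.mod_mul, mul_comm]

theorem value_lt {ω : ℕ → ℕ} {n : ℕ} (h : ∀ j ≤ n, ω j < O.radix j) : O.value ω n < O.k n := by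
  induction n with
  | zero => simpa [value, base, radix] using h 0 le_rfl
  | succ n ih =>
    have h1 := ih fun j hj => h j (hj.trans n.le_succ)
    have h2 := h (n + 1) le_rfl
    rw [value, Finset.sum_range_succ, ← value, ← O.base_mul_radix (n + 1)]
    simp only [base]
    nlinarith

theorem digit_value {ω : ℕ → ℕ} {n : ℕ} (h : ∀ j ≤ n, ω j < O.radix j) :
    ∀ j ≤ n, O.digit (O.value ω n) j = ω j := by
  induction n with
  | zero =>
    intro j hj
    obtain rfl : j = 0 := by omega
    simpa [value, base, digit] using Nat.mod_eq_of_lt (h 0 le_rfl)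
  | succ n ih =>
    intro j hj
    have h1 := O.value_lt fun j hj => h j (hj.trans n.le_succ)
    rw [value, Finset.sum_range_succ, ← value]
    rcases Nat.lt_or_ge n j with hj' | hj'
    · obtain rfl : j = n + 1 := by omega
      simp only [digit, base]
      rw [Nat.add_mul_div_right _ _ (O.k_pos n), Nat.div_eq_of_lt h1, zero_add]
      exact Nat.mod_eq_of_lt (h (n + 1) le_rfl)
    · rw [← ih (fun j hj => h j (hj.trans n.le_succ)) j hj']
      have hd : ω (n + 1) * O.base (n + 1) % O.k j = 0 :=
        Nat.mod_eq_zero_of_dvd ((O.dvd_of_le hj').mul_left _)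
      simp only [digit]
      rw [← Nat.mod_mul_right_div_self, ← Nat.mod_mul_right_div_self, O.base_mul_radix,
        Nat.add_mod, hd]
      simp

theorem digitLaw_singleton {n i : ℕ} (hi : i < O.radix n) :
    O.digitLaw n {i} = (O.radix n : ENNReal)⁻¹ := by
  rw [digitLaw, PMF.toMeasure_apply_singleton _ _ (measurableSet_singleton i)]
  simp [PMF.uniformOfFinset_apply, hi]

theorem ae_digit_lt (n : ℕ) : ∀ᵐ ω ∂(Measure.infinitePi O.digitLaw), ω n < O.radix n := by
  have h := (measurePreserving_eval_infinitePi O.digitLaw n).quasiMeasurePreserving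
  refine h.ae (p := fun x => x < O.radix n) ?_
  rw [digitLaw, ae_iff, PMF.toMeasure_apply_eq_zero_iff _ (MeasurableSet.of_discrete)]
  rw [PMF.support_uniformOfFinset, Set.disjoint_left]
  intro a ha ha'
  exact ha' (by simpa using ha)

theorem prod_radix (n : ℕ) : ∏ j ∈ Finset.range (n + 1), O.radix j = O.k n := by
  induction n with
  | zero => simp [radix, base]
  | succ n ih => rw [Finset.prod_range_succ, ih]; exact O.base_mul_radix (n + 1)

theorem measure_cylinder (n i : ℕ) (hi : i < O.k n) :
    O.measure {α : O.Space | α.1 n = i} = (O.k n : ENNReal)⁻¹ := by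
  have hm : MeasurableSet {α : O.Space | α.1 n = i} :=
    measurableSet_eq_fun ((measurable_pi_apply n).comp measurable_subtype_coe) measurable_const
  rw [measure, Measure.map_apply O.measurable_ofDigits hm]
  have hae : O.ofDigits ⁻¹' {α : O.Space | α.1 n = i} =ᵐ[Measure.infinitePi O.digitLaw]
      Set.pi (Finset.range (n + 1)) fun j => {O.digit i j} := by
    have hall := ae_all_iff.2 O.ae_digit_lt
    filter_upwards [hall] with ω hω
    refine propext ?_
    change O.value ω n % O.k n = i ↔ ω ∈ Set.pi (Finset.range (n + 1)) fun j => {O.digit i j}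
    rw [Nat.mod_eq_of_lt (O.value_lt fun j _ => hω j)]
    constructor
    · rintro rfl j hj
      have hj' : j ≤ n := by simpa [Nat.lt_succ_iff] using hj
      exact (O.digit_value (fun j _ => hω j) j hj').symm
    · intro h
      rw [← Nat.mod_eq_of_lt hi, ← O.value_digit]
      exact Finset.sum_congr rfl fun j hj => by rw [h j hj]
  rw [measure_congr hae, Measure.infinitePi_pi _ fun j _ => measurableSet_singleton _]
  have hlaw : ∀ j ∈ Finset.range (n + 1),
      O.digitLaw j {O.digit i j} = (O.radix j : ENNReal)⁻¹ :=
    fun j _ => O.digitLaw_singleton (Nat.mod_lt _ (O.radix_pos j))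
  rw [Finset.prod_congr rfl hlaw]
  rw [← ENNReal.prod_inv_distrib, ← O.prod_radix n, Nat.cast_prod]
  intro a _ b _ _
  exact Or.inr (ENNReal.natCast_ne_top _)

end OdometerSeq

/-! The proof turns the combinatorics of `I m n` into statements about factors of `T` onto finite
cyclic groups. Such a factor onto the integers modulo `k` is an eigenfunction `f` with values in
`ZMod k` that increases by one along `T`. A system is isomorphic to an odometer when eigenfunctions
of orders forming a divisibility chain generate its σ-algebra.

The key fact is `concentrated`: on the base of a late tower, `f` is nearly constant. Indeed fibres
of `f` are approximated by unions of levels, and the distribution of `f` on level `i` is that on the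
base, translated by `i`. Hence level `i` carries essentially the value `c + i`. This makes return
times to the base nearly constant modulo `k` (`exists_return_residue`), and it translates
approximation of `B l` by fibres into approximation of `I l m` by residue classes, in both
directions (`exists_residue_approx`, `exists_fibre_approx`). Conversely, if return times are
asymptotically constant modulo `k`, then level indices modulo `k`, suitably corrected, converge to
an eigenfunction (`exists_isEigen`).

For an odometer, coordinates are eigenfunctions and cylinders are dense, which gives (II). Given
(II), `exists_dvd` shows that every order that occurs divides the numbers chosen for all late bases,
so `K` is directed and belongs to an odometer. Eigenfunctions of a given order differ by constants
(`exists_eq_add`), so they can be chosen coherently and define a factor map onto that odometer. Its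
fibres approximate all bases, hence all measurable sets, and a factor map from a standard space with
this property is invertible (`exists_isInvertibleMod0`).

The completed measure is used, so that null-measurable sets and maps defined almost everywhere
become measurable. -/

/-! ### Rokhlin towers and level-by-level estimates -/

/-- A nested sequence of Rokhlin towers for a measure-preserving map `S` (playing the role of the
inverse of the transformation): the levels of the stage-`n` tower are the preimages of `B n` under
the first `h n` iterates of `S`, the base `B m` is the union of the levels of the stage-`n` tower
with indices in `I m n`, and the levels approximate every measurable set. -/
structure TowerSystem {X : Type*} [MeasurableSpace X] (μ : Measure X)
    [IsProbabilityMeasure μ] where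
  S : X → X
  preserving : MeasurePreserving S μ μ
  B : ℕ → Set X
  measurableSet_base : ∀ n, MeasurableSet (B n)
  base_ne_zero : ∀ n, μ (B n) ≠ 0
  h : ℕ → ℕ
  two_pow_le : ∀ n, 2 ^ n ≤ h n
  I : ℕ → ℕ → Finset ℕ
  I_add_le : ∀ m n, m ≤ n → ∀ i ∈ I m n, i + h m ≤ h n
  refine_base : ∀ m n, m ≤ n → B m =ᵐ[μ] ⋃ i ∈ I m n, S^[i] ⁻¹' B n
  levels_disjoint : ∀ n i j, i < h n → j < h n → i ≠ j →
    AEDisjoint μ (S^[i] ⁻¹' B n) (S^[j] ⁻¹' B n)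
  dense : ∀ A, MeasurableSet A → ∀ ε : ℝ, 0 < ε → ∃ (n : ℕ) (D : Finset ℕ),
    D ⊆ Finset.range (h n) ∧ μ.real (symmDiff A (⋃ i ∈ D, S^[i] ⁻¹' B n)) < ε

namespace TowerSystem

variable {X : Type*} [MeasurableSpace X] {μ : Measure X} [IsProbabilityMeasure μ]
  (W : TowerSystem μ)

/-- The `i`-th level of the stage-`n` tower. -/
def level (n i : ℕ) : Set X := W.S^[i] ⁻¹' W.B n

/-- The union of the levels of the stage-`n` tower. -/
def tower (n : ℕ) : Set X := ⋃ i ∈ Finset.range (W.h n), W.level n i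

/-- The measure of the base of the stage-`n` tower. -/
noncomputable def b (n : ℕ) : ℝ := μ.real (W.B n)

theorem measurableSet_level (n i : ℕ) : MeasurableSet (W.level n i) :=
  (W.preserving.iterate i).measurable (W.measurableSet_base n)

theorem measurableSet_biUnion_level (n : ℕ) (D : Finset ℕ) :
    MeasurableSet (⋃ i ∈ D, W.level n i) :=
  Finset.measurableSet_biUnion _ fun _ _ => W.measurableSet_level _ _

theorem measurableSet_tower (n : ℕ) : MeasurableSet (W.tower n) :=
  W.measurableSet_biUnion_level n _

theorem real_level (n i : ℕ) : μ.real (W.level n i) = W.b n :=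
  (W.preserving.iterate i).measureReal_preimage (W.measurableSet_base n).nullMeasurableSet

theorem b_pos (n : ℕ) : 0 < W.b n :=
  ENNReal.toReal_pos (W.base_ne_zero n) (measure_ne_top _ _)

theorem h_pos (n : ℕ) : 0 < W.h n := lt_of_lt_of_le (by positivity) (W.two_pow_le n)

theorem level_disjoint {n i j : ℕ} (hi : i < W.h n) (hj : j < W.h n) (hij : i ≠ j) :
    AEDisjoint μ (W.level n i) (W.level n j) := W.levels_disjoint n i j hi hj hij

theorem real_inter_biUnion_level (n : ℕ) {A : Set X} (hA : MeasurableSet A) {D : Finset ℕ}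
    (hD : D ⊆ Finset.range (W.h n)) :
    μ.real (A ∩ ⋃ i ∈ D, W.level n i) = ∑ i ∈ D, μ.real (A ∩ W.level n i) := by
  rw [inter_iUnion₂]
  refine measureReal_biUnion_finset₀ ?_ fun i _ =>
    (hA.inter (W.measurableSet_level n i)).nullMeasurableSet
  intro i hi j hj hij
  exact (W.level_disjoint (Finset.mem_range.1 (hD hi)) (Finset.mem_range.1 (hD hj)) hij).mono
    inter_subset_right inter_subset_right

theorem real_biUnion_level (n : ℕ) {D : Finset ℕ} (hD : D ⊆ Finset.range (W.h n)) :
    μ.real (⋃ i ∈ D, W.level n i) = D.card * W.b n := by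
  have := W.real_inter_biUnion_level n MeasurableSet.univ hD
  simpa [real_level] using this

theorem sum_inter_level_le (n : ℕ) {A : Set X} (hA : MeasurableSet A) {D : Finset ℕ}
    (hD : D ⊆ Finset.range (W.h n)) : ∑ i ∈ D, μ.real (A ∩ W.level n i) ≤ μ.real A := by
  rw [← W.real_inter_biUnion_level n hA hD]
  exact measureReal_mono inter_subset_left

/-- The form in which all later sets are estimated: a bound on each level, plus the part off the
tower as error. -/
theorem real_le_sum_inter_level (n : ℕ) {A : Set X} (hA : MeasurableSet A) :
    μ.real A ≤ ∑ i ∈ Finset.range (W.h n), μ.real (A ∩ W.level n i) + μ.real (W.tower n)ᶜ := by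
  rw [← W.real_inter_biUnion_level n hA subset_rfl]
  refine (measureReal_mono ?_).trans (measureReal_union_le _ _)
  intro x hx
  by_cases h : x ∈ W.tower n
  · exact Or.inl ⟨hx, h⟩
  · exact Or.inr h

theorem h_mul_b (n : ℕ) : W.h n * W.b n = μ.real (W.tower n) := by
  rw [tower, W.real_biUnion_level n subset_rfl, Finset.card_range]

theorem h_mul_b_le_one (n : ℕ) : W.h n * W.b n ≤ 1 := by
  rw [h_mul_b]; exact measureReal_le_one

theorem h_mul_b_add (n : ℕ) : W.h n * W.b n + μ.real (W.tower n)ᶜ = 1 := by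
  rw [h_mul_b, measureReal_add_measureReal_compl (W.measurableSet_tower n)]; simp

theorem b_le (n : ℕ) : W.b n ≤ (1 / 2) ^ n := by
  have h1 := W.h_mul_b_le_one n
  have h2 : (2 : ℝ) ^ n ≤ W.h n := by exact_mod_cast W.two_pow_le n
  have h3 := mul_le_mul_of_nonneg_right h2 (W.b_pos n).le
  rw [one_div, inv_pow, ← one_div, le_div_iff₀ (by positivity)]
  linarith

theorem exists_b_lt {ε : ℝ} (hε : 0 < ε) : ∃ N, ∀ n, N ≤ n → W.b n < ε := by
  obtain ⟨N, hN⟩ := exists_pow_lt_of_lt_one hε (by norm_num : (1 / 2 : ℝ) < 1)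
  refine ⟨N, fun n hn => ((W.b_le n).trans ?_).trans_lt hN⟩
  exact pow_le_pow_of_le_one (by norm_num) (by norm_num) hn

theorem level_refine {m n : ℕ} (hmn : m ≤ n) (a : ℕ) :
    W.level m a =ᵐ[μ] ⋃ i ∈ W.I m n, W.level n (i + a) := by
  have h := (W.preserving.iterate a).quasiMeasurePreserving.preimage_ae_eq
    (W.refine_base m n hmn)
  refine h.trans (Filter.EventuallyEq.of_eq ?_)
  simp only [preimage_iUnion, level, ← preimage_comp, ← Function.iterate_add]
  rfl

theorem I_subset {m n : ℕ} (hmn : m ≤ n) : W.I m n ⊆ Finset.range (W.h n) := fun i hi => by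
  have := W.I_add_le m n hmn i hi
  have := W.h_pos m
  rw [Finset.mem_range]; omega

/-- The dictionary between counting and measure: a proportion of `I m n` is a proportion of the
measure of `B m`. -/
theorem b_eq_card_mul {m n : ℕ} (hmn : m ≤ n) : W.b m = (W.I m n).card * W.b n := by
  rw [← W.real_biUnion_level n (W.I_subset hmn)]
  exact measureReal_congr (W.refine_base m n hmn)

theorem card_I_pos {m n : ℕ} (hmn : m ≤ n) : (0 : ℝ) < (W.I m n).card := by
  have h1 := W.b_eq_card_mul hmn
  have h2 := W.b_pos m
  rw [h1] at h2
  exact pos_of_mul_pos_left h2 (W.b_pos n).le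

theorem level_subset {m n i : ℕ} (hmn : m ≤ n) (hi : i ∈ W.I m n) :
    W.level n i ≤ᵐ[μ] W.B m := by
  refine Filter.EventuallyLE.trans ?_ (W.refine_base m n hmn).symm.le
  exact LE.le.eventuallyLE (subset_biUnion_of_mem (u := fun i => W.level n i) hi)

theorem level_aedisjoint {m n i : ℕ} (hmn : m ≤ n) (hin : i < W.h n) (hi : i ∉ W.I m n) :
    AEDisjoint μ (W.level n i) (W.B m) := by
  refine AEDisjoint.congr (t := ⋃ i ∈ W.I m n, W.level n i) (s := W.level n i) ?_
    Filter.EventuallyEq.rfl (W.refine_base m n hmn)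
  rw [AEDisjoint, inter_iUnion₂]
  refine (measure_biUnion_null_iff (W.I m n).countable_toSet).2 fun j hj => ?_
  exact W.level_disjoint hin (Finset.mem_range.1 (W.I_subset hmn hj)) (fun h => hi (h ▸ hj))

/-- A union of levels at one stage is again a union of levels at every later stage, so an
approximation persists. -/
theorem exists_dense {A : Set X} (hA : MeasurableSet A) {ε : ℝ} (hε : 0 < ε) :
    ∃ N, ∀ n, N ≤ n → ∃ D ⊆ Finset.range (W.h n),
      μ.real (symmDiff A (⋃ i ∈ D, W.level n i)) < ε := by
  obtain ⟨N, D, hD, hlt⟩ := W.dense A hA ε hε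
  refine ⟨N, fun n hn => ⟨D.biUnion fun a => (W.I N n).image (· + a), ?_, ?_⟩⟩
  · intro x hx
    simp only [Finset.mem_biUnion, Finset.mem_image] at hx
    obtain ⟨a, ha, i, hi, rfl⟩ := hx
    have := W.I_add_le N n hn i hi
    have := Finset.mem_range.1 (hD ha)
    rw [Finset.mem_range]; omega
  · refine lt_of_eq_of_lt (measureReal_congr ?_) hlt
    refine (Filter.EventuallyEq.rfl : A =ᵐ[μ] A).symmDiff ?_
    have : (⋃ i ∈ D.biUnion fun a => (W.I N n).image (· + a), W.level n i)
        = ⋃ a ∈ D, ⋃ i ∈ W.I N n, W.level n (i + a) := by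
      ext x; simp only [mem_iUnion, Finset.mem_biUnion, Finset.mem_image, exists_prop]
      constructor
      · rintro ⟨_, ⟨a, ha, i, hi, rfl⟩, hx⟩; exact ⟨a, ha, i, hi, hx⟩
      · rintro ⟨a, ha, i, hi, hx⟩; exact ⟨_, ⟨a, ha, i, hi, rfl⟩, hx⟩
    rw [this]
    exact Filter.EventuallyEq.symm (Finset.eventuallyEq_iUnion D fun a _ => W.level_refine hn a)

theorem exists_compl_tower_lt {ε : ℝ} (hε : 0 < ε) :
    ∃ N, ∀ n, N ≤ n → μ.real (W.tower n)ᶜ < ε := by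
  obtain ⟨N, hN⟩ := W.exists_dense MeasurableSet.univ hε
  refine ⟨N, fun n hn => ?_⟩
  obtain ⟨D, hD, hlt⟩ := hN n hn
  refine (measureReal_mono ?_).trans_lt hlt
  intro x hx
  refine Or.inl ⟨mem_univ x, fun h => hx ?_⟩
  exact biUnion_subset_biUnion_left hD h

/-! ### Eigenfunctions with values in a finite cyclic group -/

/-- `f` is an eigenfunction of order `k`: it increases by one along the transformation. -/
structure IsEigen (k : ℕ) (f : X → ZMod k) : Prop where
  measurable : Measurable f
  map_add_one : ∀ᵐ x ∂μ, f (W.S x) + 1 = f x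

variable {W}

namespace IsEigen

variable {k : ℕ} {f : X → ZMod k}

theorem measurableSet (hf : W.IsEigen k f) (E : Set (ZMod k)) : MeasurableSet (f ⁻¹' E) :=
  hf.measurable trivial

theorem iterate (hf : W.IsEigen k f) (i : ℕ) : ∀ᵐ x ∂μ, f (W.S^[i] x) + i = f x := by
  induction i with
  | zero => simp
  | succ i ih =>
    filter_upwards [ih, (W.preserving.iterate i).quasiMeasurePreserving.ae hf.map_add_one]
      with x h1 h2
    rw [Function.iterate_succ_apply', ← h1, ← h2]
    push_cast; ring

theorem real_level_inter (hf : W.IsEigen k f) (n i : ℕ) (E : Set (ZMod k)) :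
    μ.real (W.level n i ∩ {x | f x - i ∈ E}) = μ.real (W.B n ∩ f ⁻¹' E) := by
  rw [← (W.preserving.iterate i).measureReal_preimage
    ((W.measurableSet_base n).inter (hf.measurableSet E)).nullMeasurableSet]
  refine measureReal_congr ?_
  filter_upwards [hf.iterate i] with x hx
  apply propext
  change (x ∈ W.level n i ∧ f x - i ∈ E) ↔ x ∈ W.level n i ∧ f (W.S^[i] x) ∈ E
  rw [← hx]; simp

theorem real_preimage (hf : W.IsEigen k f) (i : ℕ) (E : Set (ZMod k)) :
    μ.real {x | f x - i ∈ E} = μ.real (f ⁻¹' E) := by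
  rw [← (W.preserving.iterate i).measureReal_preimage (hf.measurableSet E).nullMeasurableSet]
  refine measureReal_congr ?_
  filter_upwards [hf.iterate i] with x hx
  apply propext
  change (f x - i ∈ E) ↔ f (W.S^[i] x) ∈ E
  rw [← hx]; simp

end IsEigen

end TowerSystem

theorem measureReal_mono_of_ae {X : Type*} [MeasurableSpace X] {μ : Measure X} [IsFiniteMeasure μ]
    {A A' : Set X} (h : ∀ᵐ x ∂μ, x ∈ A → x ∈ A') : μ.real A ≤ μ.real A' :=
  ENNReal.toReal_mono (measure_ne_top _ _) (measure_mono_ae h)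

namespace TowerSystem

variable {X : Type*} [MeasurableSpace X] {μ : Measure X} [IsProbabilityMeasure μ]
  {W : TowerSystem μ}

theorem ae_mem_base_of_mem_level {m n i : ℕ} (hmn : m ≤ n) (hi : i ∈ W.I m n) :
    ∀ᵐ x ∂μ, x ∈ W.level n i → x ∈ W.B m := W.level_subset hmn hi

theorem ae_notMem_base_of_mem_level {m n i : ℕ} (hmn : m ≤ n) (hin : i < W.h n)
    (hi : i ∉ W.I m n) : ∀ᵐ x ∂μ, x ∈ W.level n i → x ∉ W.B m := by
  have h := W.level_aedisjoint hmn hin hi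
  rw [AEDisjoint, measure_eq_zero_iff_ae_notMem] at h
  filter_upwards [h] with x hx h1 h2 using hx ⟨h1, h2⟩

theorem ae_notMem_biUnion_level {n i : ℕ} (hin : i < W.h n) {D : Finset ℕ}
    (hD : D ⊆ Finset.range (W.h n)) (hi : i ∉ D) :
    ∀ᵐ x ∂μ, x ∈ W.level n i → x ∉ ⋃ j ∈ D, W.level n j := by
  have h : ∀ j ∈ D, ∀ᵐ x ∂μ, x ∉ W.level n i ∩ W.level n j := fun j hj => by
    rw [← measure_eq_zero_iff_ae_notMem]
    exact W.level_disjoint hin (Finset.mem_range.1 (hD hj)) fun h => hi (h ▸ hj)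
  have h' := (Finset.eventually_all D).2 h
  filter_upwards [h'] with x hx h1 h2
  simp only [mem_iUnion] at h2
  obtain ⟨j, hj, h3⟩ := h2
  exact hx j hj ⟨h1, h3⟩

/-! ### Concentration on late bases and its combinatorial consequences -/

namespace IsEigen

variable {k : ℕ} {f : X → ZMod k}

theorem real_level_inter_eq (hf : W.IsEigen k f) (n i : ℕ) (c : ZMod k) :
    μ.real (W.level n i ∩ {x | f x = c}) = μ.real (W.B n ∩ f ⁻¹' {c - i}) := by
  rw [← hf.real_level_inter n i {c - i}]
  congr 2; ext x; simp [sub_left_inj]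

theorem real_level_inter_ne (hf : W.IsEigen k f) (n i : ℕ) (c : ZMod k) :
    μ.real (W.level n i ∩ {x | f x ≠ c}) = W.b n - μ.real (W.B n ∩ f ⁻¹' {c - i}) := by
  rw [← hf.real_level_inter_eq n i c, ← W.real_level n i, eq_sub_iff_add_eq, add_comm]
  have := measureReal_inter_add_sdiff (μ := μ) (s := W.level n i) (hf.measurableSet {c})
  exact this

theorem sum_real_inter_preimage [NeZero k] (hf : W.IsEigen k f) (n : ℕ) :
    ∑ c, μ.real (W.B n ∩ f ⁻¹' {c}) = W.b n := by
  rw [b, ← measureReal_biUnion_finset]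
  · congr 1; ext x; simp
  · intro c _ d _ hcd
    refine disjoint_left.2 fun x hx hx' => hcd ?_
    rw [← (hx.2 : f x = c), ← (hx'.2 : f x = d)]
  · exact fun c _ => (W.measurableSet_base n).inter (hf.measurableSet _)

/-- Approximating a fibre by levels forces most levels to lie almost inside or almost outside it.
All levels carry translates of one distribution, so summing over fibres and levels shows that this
distribution has every atom close to zero or to full mass; the total mass then leaves one dominant
atom. -/
theorem concentrated [NeZero k] (hf : W.IsEigen k f) {η : ℝ} (hη : 0 < η) :
    ∃ N, ∀ n, N ≤ n → ∃ c : ZMod k, μ.real (W.B n ∩ {x | f x ≠ c}) ≤ η * W.b n := by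
  set θ : ℝ := min η (1 / 2) with hθ
  have hθ0 : 0 < θ := lt_min hη (by norm_num)
  have hk : (0 : ℝ) < k := by exact_mod_cast Nat.pos_of_ne_zero (NeZero.ne k)
  have hδ : 0 < θ / (2 * k) := by positivity
  choose N hN using fun c : ZMod k => W.exists_dense (hf.measurableSet {c}) hδ
  obtain ⟨M, hM⟩ := W.exists_compl_tower_lt (show (0 : ℝ) < 1 / 2 by norm_num)
  refine ⟨max M (Finset.univ.sup N), fun n hn => ?_⟩
  have hn1 : ∀ c, N c ≤ n := fun c =>
    (Finset.le_sup (Finset.mem_univ c)).trans ((le_max_right _ _).trans hn)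
  have hhb : 1 / 2 ≤ W.h n * W.b n := by
    have := hM n ((le_max_left _ _).trans hn)
    have := W.h_mul_b_add n
    linarith
  set β : ZMod k → ℝ := fun c => μ.real (W.B n ∩ f ⁻¹' {c}) with hβ
  -- The least possible error when a level whose fibre part has measure `β c` must be taken entirely
  -- or not at all.
  set q : ZMod k → ℝ := fun c => min (β c) (W.b n - β c) with hq
  have key : ∀ c, ∑ i ∈ Finset.range (W.h n), q (c - i) ≤ θ / (2 * k) := fun c => by
    obtain ⟨D, hD, hlt⟩ := hN c n (hn1 c)
    refine le_trans ?_ hlt.le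
    refine le_trans (Finset.sum_le_sum fun i hi => ?_) (W.sum_inter_level_le n
      ((hf.measurableSet {c}).symmDiff (W.measurableSet_biUnion_level n D)) subset_rfl)
    rw [Finset.mem_range] at hi
    by_cases hiD : i ∈ D
    · refine (min_le_right _ _).trans ?_
      change W.b n - μ.real (W.B n ∩ f ⁻¹' {c - (i : ZMod k)}) ≤ _
      rw [← hf.real_level_inter_ne n i c]
      refine measureReal_mono fun x hx => ⟨Or.inr ⟨?_, hx.2⟩, hx.1⟩
      exact mem_biUnion (t := fun i => W.level n i) hiD hx.1
    · refine (min_le_left _ _).trans ?_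
      change μ.real (W.B n ∩ f ⁻¹' {c - (i : ZMod k)}) ≤ _
      rw [← hf.real_level_inter_eq n i c]
      refine measureReal_mono_of_ae ?_
      filter_upwards [ae_notMem_biUnion_level hi hD hiD] with x hx h
      exact ⟨Or.inl ⟨h.2, hx h.1⟩, h.1⟩
  have hsum : W.h n * ∑ c, q c ≤ θ / 2 := by
    have h1 : ∑ c : ZMod k, ∑ i ∈ Finset.range (W.h n), q (c - i) ≤ ∑ _c : ZMod k, θ / (2 * k) :=
      Finset.sum_le_sum fun c _ => key c
    rw [Finset.sum_comm] at h1
    -- Summing over all fibres removes the translation, so every level contributes the same total.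
    have h2 : ∀ i ∈ Finset.range (W.h n), ∑ c, q (c - i) = ∑ c, q c := fun i _ =>
      Equiv.sum_comp (Equiv.subRight (i : ZMod k)) q
    rw [Finset.sum_congr rfl h2] at h1
    simp only [Finset.sum_const, Finset.card_range, nsmul_eq_mul, Finset.card_univ,
      ZMod.card] at h1
    refine h1.trans (le_of_eq ?_)
    field_simp
  have hβ0 : ∀ c, 0 ≤ β c := fun c => measureReal_nonneg
  have hβb : ∀ c, β c ≤ W.b n := fun c => measureReal_mono inter_subset_left
  have hq0 : ∀ c, 0 ≤ q c := fun c => le_min (hβ0 c) (sub_nonneg.2 (hβb c))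
  have hb := W.b_pos n
  have hqs : ∑ c, q c ≤ θ * W.b n := by
    have hh : (0 : ℝ) < W.h n := by exact_mod_cast W.h_pos n
    refine le_of_mul_le_mul_left (hsum.trans ?_) hh
    nlinarith
  -- If no atom had more than half the mass, the sum of `q` would be all of `W.b n`, against the
  -- bound `θ * W.b n` with `θ ≤ 1 / 2`.
  obtain ⟨c, hc⟩ : ∃ c, W.b n - β c < β c := by
    by_contra! hcon
    have : ∑ c, q c = W.b n := by
      rw [← hf.sum_real_inter_preimage n]
      exact Finset.sum_congr rfl fun c _ => min_eq_left (hcon c)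
    rw [this] at hqs
    have : θ ≤ 1 / 2 := min_le_right _ _
    nlinarith
  refine ⟨c, ?_⟩
  have h1 := hf.real_level_inter_ne n 0 c
  simp only [level, Function.iterate_zero, preimage_id, Nat.cast_zero, sub_zero] at h1
  rw [h1]
  have h2 : q c ≤ ∑ c, q c := Finset.single_le_sum (fun c _ => hq0 c) (Finset.mem_univ c)
  have h3 : q c = W.b n - β c := min_eq_right hc.le
  have h4 : θ * W.b n ≤ η * W.b n := mul_le_mul_of_nonneg_right (min_le_left _ _) hb.le
  change W.b n - β c ≤ _
  linarith

theorem real_level_inter_ne_le (hf : W.IsEigen k f) {n : ℕ} {c : ZMod k} {η : ℝ}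
    (hc : μ.real (W.B n ∩ {x | f x ≠ c}) ≤ η * W.b n) (i : ℕ) :
    μ.real (W.level n i ∩ {x | f x ≠ c + i}) ≤ η * W.b n := by
  refine le_trans (le_of_eq ?_) hc
  have h1 := hf.real_level_inter_ne n 0 c
  simp only [level, Function.iterate_zero, preimage_id, Nat.cast_zero, sub_zero] at h1
  rw [h1, hf.real_level_inter_ne, add_sub_cancel_right]

theorem le_real_level_inter (hf : W.IsEigen k f) {n : ℕ} {c : ZMod k} {η : ℝ}
    (hc : μ.real (W.B n ∩ {x | f x ≠ c}) ≤ η * W.b n) (i : ℕ) :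
    (1 - η) * W.b n ≤ μ.real (W.level n i ∩ {x | f x = c + i}) := by
  have h1 := hf.real_level_inter_ne_le hc i
  rw [hf.real_level_inter_ne, ← hf.real_level_inter_eq] at h1
  linarith

/-- An eigenfunction makes the return times to the base almost constant modulo its order. -/
theorem exists_return_residue [NeZero k] (hf : W.IsEigen k f) {η : ℝ} (hη : 0 < η) :
    ∃ N, ∀ m n, N ≤ m → m < n → ∃ j < k,
      (((W.I m n).filter fun i => i % k ≠ j).card : ℝ) / (W.I m n).card < η := by
  -- The estimate below gives a proportion at most `θ / (1 - θ)`, which is at most `2 * θ ≤ η / 2`.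
  set θ : ℝ := min (η / 4) (1 / 2) with hθ
  have hθ0 : 0 < θ := lt_min (by positivity) (by norm_num)
  obtain ⟨N, hN⟩ := hf.concentrated hθ0
  refine ⟨N, fun m n hm hmn => ?_⟩
  obtain ⟨c, hc⟩ := hN m hm
  obtain ⟨d, hd⟩ := hN n (hm.trans hmn.le)
  refine ⟨(c - d).val, ZMod.val_lt _, ?_⟩
  set J := (W.I m n).filter fun i => i % k ≠ (c - d).val with hJ
  have hJr : J ⊆ Finset.range (W.h n) := (Finset.filter_subset _ _).trans (W.I_subset hmn.le)
  -- Level `i` with `i ∈ J` lies in `B m` but has mostly the value `d + i ≠ c`, so it uses up the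
  -- small exceptional part of `B m`.
  have h1 : ∑ i ∈ J, (1 - θ) * W.b n ≤ θ * W.b m := by
    refine le_trans (Finset.sum_le_sum fun i hi => ?_) ((W.sum_inter_level_le n
      ((W.measurableSet_base m).inter (hf.measurableSet {c}ᶜ)) hJr).trans hc)
    refine (hf.le_real_level_inter hd i).trans (measureReal_mono_of_ae ?_)
    rw [hJ, Finset.mem_filter] at hi
    filter_upwards [ae_mem_base_of_mem_level hmn.le hi.1] with x hx h
    refine ⟨⟨hx h.1, fun h' => hi.2 ?_⟩, h.1⟩
    have h2 : c = d + i := (h' : f x = c).symm.trans h.2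
    rw [h2, add_sub_cancel_left, ZMod.val_natCast]
  rw [Finset.sum_const, nsmul_eq_mul, W.b_eq_card_mul hmn.le] at h1
  have hb := W.b_pos n
  have hI := W.card_I_pos hmn.le
  rw [div_lt_iff₀ hI]
  have h2 : (J.card : ℝ) * (1 - θ) ≤ θ * (W.I m n).card := by
    refine le_of_mul_le_mul_right ?_ hb
    linarith
  have h3 : θ ≤ η / 4 := min_le_left _ _
  have h4 : θ ≤ 1 / 2 := min_le_right _ _
  have h5 : (0 : ℝ) ≤ J.card := by positivity
  nlinarith

/-- If a base is approximated by a union of fibres of an eigenfunction, then the corresponding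
index sets are approximated by unions of residue classes. -/
theorem exists_residue_approx [NeZero k] (hf : W.IsEigen k f) {l : ℕ} {E : Set (ZMod k)} {ε : ℝ}
    (hε : 0 < ε) (hE : μ.real (symmDiff (W.B l) (f ⁻¹' E)) < ε / 4 * W.b l) :
    ∃ N, ∀ m, N ≤ m → ∃ D ⊆ Finset.range k,
      ((symmDiff ((Finset.range (W.h m + 1)).filter fun i => i % k ∈ D) (W.I l m)).card : ℝ)
        / (W.I l m).card < ε := by
  classical
  obtain ⟨N, hN⟩ := hf.concentrated (show (0 : ℝ) < 1 / 2 by norm_num)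
  -- This half of the error pays for the one index `i = h m`, which is not the index of a level of
  -- the tower.
  obtain ⟨M, hM⟩ := W.exists_b_lt (show 0 < ε / 2 * W.b l by have := W.b_pos l; positivity)
  refine ⟨max (max N M) l, fun m hm => ?_⟩
  have hlm : l ≤ m := (le_max_right _ _).trans hm
  obtain ⟨c, hc⟩ := hN m (((le_max_left _ _).trans (le_max_left _ _)).trans hm)
  have hMm := hM m (((le_max_right _ _).trans (le_max_left _ _)).trans hm)
  -- Level `i` has mostly the value `c + i`, so it lies mostly in `f ⁻¹' E` exactly when the residue
  -- of `i` is in `D`.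
  set D : Finset ℕ := (Finset.range k).filter fun d : ℕ => c + (d : ZMod k) ∈ E with hD
  refine ⟨D, Finset.filter_subset _ _, ?_⟩
  set Q := symmDiff ((Finset.range (W.h m + 1)).filter fun i => i % k ∈ D) (W.I l m) with hQ
  have hQmem : ∀ i, i < W.h m → (i ∈ Q ↔ ¬ (c + (i : ZMod k) ∈ E ↔ i ∈ W.I l m)) := fun i hi => by
    have h1 : i < W.h m + 1 := by omega
    have h2 : i % k < k := Nat.mod_lt _ (Nat.pos_of_ne_zero (NeZero.ne k))
    rw [hQ, Finset.mem_symmDiff]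
    simp only [hD, Finset.mem_filter, Finset.mem_range, h1, h2, true_and, ZMod.natCast_mod]
    tauto
  have hsum : ∑ i ∈ Q.filter (· < W.h m), (1 - 1 / 2) * W.b m ≤ ε / 4 * W.b l := by
    refine le_trans (Finset.sum_le_sum fun i hi => ?_) ((W.sum_inter_level_le m
      ((W.measurableSet_base l).symmDiff (hf.measurableSet E)) fun i hi =>
        Finset.mem_range.2 (Finset.mem_filter.1 hi).2).trans hE.le)
    obtain ⟨hiQ, him⟩ := Finset.mem_filter.1 hi
    rw [hQmem i him] at hiQ
    refine (hf.le_real_level_inter hc i).trans (measureReal_mono_of_ae ?_)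
    by_cases hI : i ∈ W.I l m
    · filter_upwards [ae_mem_base_of_mem_level hlm hI] with x hx h
      refine ⟨Or.inl ⟨hx h.1, fun h' => hiQ ?_⟩, h.1⟩
      have h2 : f x ∈ E := h'
      rw [(h.2 : f x = c + i)] at h2
      tauto
    · filter_upwards [ae_notMem_base_of_mem_level hlm him hI] with x hx h
      refine ⟨Or.inr ⟨?_, hx h.1⟩, h.1⟩
      change f x ∈ E
      rw [(h.2 : f x = c + i)]
      tauto
  have hcard : Q.card ≤ (Q.filter (· < W.h m)).card + 1 := by
    refine (Finset.card_le_card (t := insert (W.h m) (Q.filter (· < W.h m))) fun i hi => ?_).trans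
      (Finset.card_insert_le _ _)
    rw [Finset.mem_insert, Finset.mem_filter]
    by_cases h : i < W.h m
    · exact Or.inr ⟨hi, h⟩
    · left
      rcases Finset.mem_symmDiff.1 hi with ⟨h1, -⟩ | ⟨h1, -⟩
      · have := Finset.mem_range.1 (Finset.mem_filter.1 h1).1
        omega
      · exact absurd (Finset.mem_range.1 (W.I_subset hlm h1)) h
  have hcard' : (Q.card : ℝ) ≤ (Q.filter (· < W.h m)).card + 1 := by exact_mod_cast hcard
  rw [Finset.sum_const, nsmul_eq_mul] at hsum
  have hb := W.b_pos m
  rw [div_lt_iff₀ (W.card_I_pos hlm)]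
  refine lt_of_mul_lt_mul_right ?_ hb.le
  rw [mul_assoc, ← W.b_eq_card_mul hlm]
  nlinarith

/-- If `I l m` is approximated by unions of residue classes modulo the order of an eigenfunction
for large `m`, then `B l` is approximated by a union of fibres of the eigenfunction. -/
theorem exists_fibre_approx [NeZero k] (hf : W.IsEigen k f) {l : ℕ} {ε : ℝ}
    (hε : 0 < ε) (hD : ∃ N, ∀ m, N ≤ m → ∃ D ⊆ Finset.range k,
      ((symmDiff ((Finset.range (W.h m + 1)).filter fun i => i % k ∈ D) (W.I l m)).card : ℝ)
        / (W.I l m).card < ε) :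
    ∃ E : Set (ZMod k), μ.real (symmDiff (W.B l) (f ⁻¹' E)) ≤ 2 * ε * W.b l := by
  classical
  have hbl := W.b_pos l
  have hη : 0 < ε / 2 * W.b l := by positivity
  obtain ⟨N₁, hN₁⟩ := hf.concentrated hη
  obtain ⟨N₂, hN₂⟩ := W.exists_compl_tower_lt hη
  obtain ⟨N₃, hN₃⟩ := hD
  obtain ⟨m, h1m, h2m, h3m, hlm⟩ : ∃ m, N₁ ≤ m ∧ N₂ ≤ m ∧ N₃ ≤ m ∧ l ≤ m :=
    ⟨N₁ + N₂ + N₃ + l, by omega, by omega, by omega, by omega⟩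
  obtain ⟨c, hc⟩ := hN₁ m h1m
  obtain ⟨D, hDk, hDlt⟩ := hN₃ m h3m
  set Q := symmDiff ((Finset.range (W.h m + 1)).filter fun i => i % k ∈ D) (W.I l m) with hQ
  have hQmem : ∀ i, i < W.h m → (i ∈ Q ↔ ¬ (i % k ∈ D ↔ i ∈ W.I l m)) := fun i hi => by
    have h1 : i < W.h m + 1 := by omega
    rw [hQ, Finset.mem_symmDiff]
    simp only [Finset.mem_filter, Finset.mem_range, h1, true_and]
    tauto
  set E : Set (ZMod k) := {e | (e - c).val ∈ D} with hE
  have hEmem : ∀ i : ℕ, c + (i : ZMod k) ∈ E ↔ i % k ∈ D := fun i => by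
    change (c + (i : ZMod k) - c).val ∈ D ↔ _
    rw [add_sub_cancel_left, ZMod.val_natCast]
  refine ⟨E, ?_⟩
  have hb := W.b_pos m
  -- On a correctly classified level only the points where `f` differs from `c + i` contribute; a
  -- misclassified level is counted in full.
  have hlev : ∀ i ∈ Finset.range (W.h m), μ.real (symmDiff (W.B l) (f ⁻¹' E) ∩ W.level m i) ≤
      (ε / 2 * W.b l) * W.b m + if i ∈ Q then W.b m else 0 := fun i hi => by
    rw [Finset.mem_range] at hi
    split_ifs with hiQ
    · have h1 : μ.real (symmDiff (W.B l) (f ⁻¹' E) ∩ W.level m i) ≤ W.b m := by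
        rw [← W.real_level m i]; exact measureReal_mono inter_subset_right
      have : 0 ≤ (ε / 2 * W.b l) * W.b m := by positivity
      linarith
    · rw [add_zero]
      refine le_trans (measureReal_mono_of_ae ?_) (hf.real_level_inter_ne_le hc i)
      rw [hQmem i hi, not_not, ← hEmem] at hiQ
      by_cases hI : i ∈ W.I l m
      · filter_upwards [ae_mem_base_of_mem_level hlm hI] with x hx h
        refine ⟨h.2, fun h' => ?_⟩
        have h4 : f x ∈ E := by rw [h']; exact hiQ.2 hI
        rcases h.1 with h5 | h5
        · exact h5.2 h4
        · exact h5.2 (hx h.2)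
      · filter_upwards [ae_notMem_base_of_mem_level hlm hi hI] with x hx h
        refine ⟨h.2, fun h' => ?_⟩
        have h4 : f x ∉ E := by rw [h']; exact fun h6 => hI (hiQ.1 h6)
        rcases h.1 with h5 | h5
        · exact hx h.2 h5.1
        · exact h4 h5.1
  have h1 := W.real_le_sum_inter_level m ((W.measurableSet_base l).symmDiff (hf.measurableSet E))
  have h2 := Finset.sum_le_sum hlev
  rw [Finset.sum_add_distrib, Finset.sum_const, nsmul_eq_mul, Finset.card_range,
    ← Finset.sum_filter, Finset.sum_const, nsmul_eq_mul] at h2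
  have h3 : (((Finset.range (W.h m)).filter (· ∈ Q)).card : ℝ) ≤ Q.card := by
    exact_mod_cast Finset.card_le_card fun i hi => (Finset.mem_filter.1 hi).2
  rw [div_lt_iff₀ (W.card_I_pos hlm)] at hDlt
  have h4 : (Q.card : ℝ) * W.b m ≤ ε * W.b l := by
    rw [W.b_eq_card_mul hlm, ← mul_assoc]
    exact mul_le_mul_of_nonneg_right hDlt.le hb.le
  have h5 := W.h_mul_b_le_one m
  have h6 := hN₂ m h2m
  have h7 : W.h m * (ε / 2 * W.b l * W.b m) ≤ ε / 2 * W.b l := by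
    calc W.h m * (ε / 2 * W.b l * W.b m) = ε / 2 * W.b l * (W.h m * W.b m) := by ring
      _ ≤ ε / 2 * W.b l * 1 := mul_le_mul_of_nonneg_left h5 hη.le
      _ = _ := mul_one _
  have h8 := mul_le_mul_of_nonneg_right h3 hb.le
  linarith

end IsEigen

end TowerSystem

/-! ### Borel–Cantelli, and rigidity of eigenfunctions -/

theorem ae_eventually_notMem_of_summable {X : Type*} [MeasurableSpace X] {μ : Measure X}
    [IsFiniteMeasure μ] {s : ℕ → Set X} {u : ℕ → ℝ} (hu : Summable u)
    (hs : ∀ p, μ.real (s p) ≤ u p) : ∀ᵐ x ∂μ, ∀ᶠ p in Filter.atTop, x ∉ s p := by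
  refine ae_eventually_notMem (ne_top_of_le_ne_top hu.tsum_ofReal_ne_top
    (ENNReal.tsum_le_tsum fun p => ?_))
  rw [← ofReal_measureReal]
  exact ENNReal.ofReal_le_ofReal (hs p)

namespace TowerSystem

variable {X : Type*} [MeasurableSpace X] {μ : Measure X} [IsProbabilityMeasure μ]
  {W : TowerSystem μ}

namespace IsEigen

variable {k : ℕ} {f : X → ZMod k}

theorem cast [NeZero k] {d : ℕ} (hf : W.IsEigen k f) (hd : d ∣ k) :
    W.IsEigen d fun x => ZMod.castHom hd (ZMod d) (f x) where
  measurable := (measurable_of_countable _).comp hf.measurable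
  map_add_one := by
    filter_upwards [hf.map_add_one] with x hx
    rw [← hx, map_add, map_one]

theorem add_const [NeZero k] (hf : W.IsEigen k f) (c : ZMod k) : W.IsEigen k fun x => f x + c where
  measurable := (measurable_of_countable (· + c)).comp hf.measurable
  map_add_one := by
    filter_upwards [hf.map_add_one] with x hx
    rw [← hx]; ring

/-- Iterates of `S` permute the fibres cyclically and preserve measure. -/
theorem real_fibre [NeZero k] (hf : W.IsEigen k f) (c : ZMod k) : μ.real (f ⁻¹' {c}) = 1 / k := by
  have h0 : ∀ c : ZMod k, μ.real (f ⁻¹' {c}) = μ.real (f ⁻¹' {0}) := fun c => by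
    rw [← hf.real_preimage c.val {0}]
    congr 1; ext x
    simp [sub_eq_zero]
  have h1 : ∑ c : ZMod k, μ.real (f ⁻¹' {c}) = 1 := by
    rw [← measureReal_biUnion_finset]
    · have : (⋃ c ∈ (Finset.univ : Finset (ZMod k)), f ⁻¹' {c}) = univ := by ext x; simp
      rw [this]; simp
    · intro c _ d _ hcd
      refine disjoint_left.2 fun x hx hx' => hcd ?_
      rw [← (hx : f x = c), ← (hx' : f x = d)]
    · exact fun c _ => hf.measurableSet _
  rw [Finset.sum_congr rfl fun c _ => h0 c, Finset.sum_const, nsmul_eq_mul, Finset.card_univ,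
    ZMod.card] at h1
  have hk : (k : ℝ) ≠ 0 := by exact_mod_cast NeZero.ne k
  rw [h0 c]
  field_simp
  linarith

/-- Two eigenfunctions of the same order differ by a constant. -/
theorem exists_eq_add [NeZero k] {g : X → ZMod k} (hf : W.IsEigen k f) (hg : W.IsEigen k g) :
    ∃ c, ∀ᵐ x ∂μ, g x = f x + c := by
  -- On a late tower `f` is mostly `c + i` and `g` mostly `d + i` on level `i`, so their difference
  -- is mostly `d - c`.
  have key : ∀ η : ℝ, 0 < η → ∃ c, μ.real {x | g x ≠ f x + c} ≤ η := fun η hη => by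
    have hη4 : 0 < η / 4 := by positivity
    have hη2 : 0 < η / 2 := by positivity
    obtain ⟨N₁, h₁⟩ := hf.concentrated hη4
    obtain ⟨N₂, h₂⟩ := hg.concentrated hη4
    obtain ⟨N₃, h₃⟩ := W.exists_compl_tower_lt hη2
    obtain ⟨n, hn1, hn2, hn3⟩ : ∃ m, N₁ ≤ m ∧ N₂ ≤ m ∧ N₃ ≤ m :=
      ⟨N₁ + N₂ + N₃, by omega, by omega, by omega⟩
    obtain ⟨c, hc⟩ := h₁ n hn1
    obtain ⟨d, hd⟩ := h₂ n hn2
    refine ⟨d - c, ?_⟩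
    have hA : MeasurableSet {x | g x ≠ f x + (d - c)} :=
      (measurableSet_eq_fun hg.measurable
        (hf.add_const (d - c)).measurable).compl
    have h4 := W.real_le_sum_inter_level n hA
    have h5 : ∀ i ∈ Finset.range (W.h n), μ.real ({x | g x ≠ f x + (d - c)} ∩ W.level n i) ≤
        η / 2 * W.b n := fun i _ => by
      have h6 := hf.real_level_inter_ne_le hc i
      have h7 := hg.real_level_inter_ne_le hd i
      refine (measureReal_mono (fun x hx => ?_)).trans ((measureReal_union_le
        (W.level n i ∩ {x | f x ≠ c + i}) (W.level n i ∩ {x | g x ≠ d + i})).trans (by linarith))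
      by_cases hfx : f x = c + i
      · refine Or.inr ⟨hx.2, fun hgx => hx.1 ?_⟩
        have : g x = d + i := hgx
        rw [hfx, this]; ring
      · exact Or.inl ⟨hx.2, hfx⟩
    have h6 := Finset.sum_le_sum h5
    rw [Finset.sum_const, nsmul_eq_mul, Finset.card_range] at h6
    have h7 := W.h_mul_b_le_one n
    have h8 := h₃ n hn3
    nlinarith
  -- The constant found above depends on `η`; as there are finitely many, a best one serves for
  -- every `η`.
  obtain ⟨c, hc⟩ := Finite.exists_min fun c => μ.real {x | g x ≠ f x + c}
  refine ⟨c, ?_⟩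
  have h0 : μ.real {x | g x ≠ f x + c} = 0 := by
    refine le_antisymm (le_of_forall_pos_le_add fun η hη => ?_) measureReal_nonneg
    obtain ⟨d, hd⟩ := key η hη
    rw [zero_add]
    exact (hc d).trans hd
  rwa [measureReal_eq_zero_iff] at h0

/-- The order of an eigenfunction divides the order of every other eigenfunction that has fibres
close to the base of a late tower. -/
theorem exists_dvd [NeZero k] (hf : W.IsEigen k f) : ∃ N, ∀ l, N ≤ l →
    ∀ (k' : ℕ) (g : X → ZMod k') (E : Set (ZMod k')), W.IsEigen k' g →
      μ.real (symmDiff (W.B l) (g ⁻¹' E)) ≤ 1 / 5 * W.b l → k ∣ k' := by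
  obtain ⟨N, hN⟩ := hf.concentrated (show (0 : ℝ) < 1 / 10 by norm_num)
  refine ⟨N, fun l hl k' g E hg hE => ?_⟩
  obtain ⟨c, hc⟩ := hN l hl
  by_contra hdvd
  rw [← ZMod.natCast_eq_zero_iff] at hdvd
  have hb := W.b_pos l
  have h1 : μ.real (g ⁻¹' E ∩ {x | f x ≠ c}) ≤ 3 / 10 * W.b l := by
    refine (measureReal_mono (fun x hx => ?_)).trans ((measureReal_union_le
      (symmDiff (W.B l) (g ⁻¹' E)) (W.B l ∩ {x | f x ≠ c})).trans (by linarith))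
    by_cases hxB : x ∈ W.B l
    · exact Or.inr ⟨hxB, hx.2⟩
    · exact Or.inl (Or.inr ⟨hx.1, hxB⟩)
  have h2 : W.b l ≤ 1 / 5 * W.b l + (μ.real (g ⁻¹' E ∩ {x | f x = c}) +
      μ.real (g ⁻¹' E ∩ {x | f x ≠ c})) := by
    refine (measureReal_mono (fun x hx => ?_)).trans ((measureReal_union_le
      (symmDiff (W.B l) (g ⁻¹' E)) _).trans (add_le_add hE (measureReal_union_le
      (g ⁻¹' E ∩ {x | f x = c}) (g ⁻¹' E ∩ {x | f x ≠ c}))))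
    by_cases hxE : x ∈ g ⁻¹' E
    · by_cases hxc : f x = c
      · exact Or.inr (Or.inl ⟨hxE, hxc⟩)
      · exact Or.inr (Or.inr ⟨hxE, hxc⟩)
    · exact Or.inl (Or.inl ⟨hx, hxE⟩)
  -- Along `S^[k']` the function `g` is invariant while `f` changes by `k' ≠ 0` in `ZMod k`. So the
  -- value `c` takes at most half of `g ⁻¹' E`, although `B l` is nearly `g ⁻¹' E` and has mostly
  -- the value `c`. Numerically, the mass `1` of the base would be at most `1/5 + 3/10 + 3/10`.
  have h3 : μ.real (g ⁻¹' E ∩ {x | f x = c}) ≤ μ.real (g ⁻¹' E ∩ {x | f x ≠ c}) := by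
    change μ.real (g ⁻¹' E ∩ f ⁻¹' {c}) ≤ _
    rw [← (W.preserving.iterate k').measureReal_preimage
      ((hg.measurableSet E).inter (hf.measurableSet {c})).nullMeasurableSet]
    refine measureReal_mono_of_ae ?_
    filter_upwards [hf.iterate k', hg.iterate k'] with x hx hx' h
    have h5 : g (W.S^[k'] x) ∈ E := h.1
    have h6 : f (W.S^[k'] x) = c := h.2
    rw [ZMod.natCast_self, add_zero] at hx'
    refine ⟨?_, fun h' => hdvd ?_⟩
    · change g x ∈ E
      rwa [← hx']
    · have h7 : f x = c := h'
      rw [h6, h7] at hx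
      simpa using hx
  linarith

/-- Since `E` cannot be empty, some whole fibre, of measure `1 / k`, is covered by `B l` and the
error set. -/
theorem order_lower_bound [NeZero k] (hf : W.IsEigen k f) {l : ℕ} {E : Set (ZMod k)}
    (hE : μ.real (symmDiff (W.B l) (f ⁻¹' E)) ≤ 1 / 5 * W.b l) : 1 / 2 / W.b l ≤ k := by
  have hb := W.b_pos l
  have hk : (0 : ℝ) < k := by exact_mod_cast Nat.pos_of_ne_zero (NeZero.ne k)
  obtain ⟨e, he⟩ : E.Nonempty := by
    by_contra hne
    rw [not_nonempty_iff_eq_empty] at hne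
    subst hne
    have h0 : symmDiff (W.B l) (f ⁻¹' ∅) = W.B l := by
      rw [preimage_empty]; exact symmDiff_bot _
    rw [h0] at hE
    change W.b l ≤ _ at hE
    linarith
  have h1 : μ.real (f ⁻¹' {e}) ≤ 1 / 5 * W.b l + W.b l := by
    refine (measureReal_mono (fun x hx => ?_)).trans ((measureReal_union_le
      (symmDiff (W.B l) (f ⁻¹' E)) (W.B l)).trans (add_le_add hE le_rfl))
    by_cases hxB : x ∈ W.B l
    · exact Or.inr hxB
    · refine Or.inl (Or.inr ⟨?_, hxB⟩)
      rw [mem_preimage, (hx : f x = e)]; exact he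
  rw [hf.real_fibre, div_le_iff₀ hk] at h1
  rw [div_le_iff₀ hb]
  nlinarith

end IsEigen

/-! ### Construction of an eigenfunction from the return times -/

variable (W)

/-- The index of the level of the stage-`n` tower modulo `k`. -/
noncomputable def stage (k n : ℕ) (x : X) : ZMod k :=
  ∑ i ∈ Finset.range (W.h n), (W.level n i).indicator (fun _ => (i : ZMod k)) x

theorem measurable_stage (k n : ℕ) [NeZero k] : Measurable (W.stage k n) :=
  Finset.measurable_sum _ fun i _ => measurable_const.indicator (W.measurableSet_level n i)

variable {W}

theorem ae_stage_eq (k : ℕ) {n i : ℕ} (hi : i < W.h n) :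
    ∀ᵐ x ∂μ, x ∈ W.level n i → W.stage k n x = i := by
  have h : ∀ᵐ x ∂μ, x ∈ W.level n i → x ∉ ⋃ j ∈ (Finset.range (W.h n)).erase i, W.level n j :=
    ae_notMem_biUnion_level hi (Finset.erase_subset _ _) (Finset.notMem_erase _ _)
  filter_upwards [h] with x hx hxi
  have h1 := hx hxi
  simp only [mem_iUnion, not_exists] at h1
  rw [stage, Finset.sum_eq_single i]
  · exact indicator_of_mem hxi _
  · intro j hj hji
    exact indicator_of_notMem (h1 j (Finset.mem_erase.2 ⟨hji, hj⟩)) _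
  · intro hn
    exact absurd (Finset.mem_range.2 hi) hn

/-- Level `a` at stage `m` splits into the levels `i + a` at stage `n` with `i ∈ I m n`. There the
two indices differ by `i`, which is `j` modulo `k` apart from a small proportion. -/
theorem real_stage_sub_stage_ne_le (k : ℕ) [NeZero k] {m n j : ℕ} (hmn : m < n) {η : ℝ} (hη : 0 ≤ η)
    (hj : (((W.I m n).filter fun i => i % k ≠ j).card : ℝ) / (W.I m n).card < η) :
    μ.real {x | W.stage k n x - W.stage k m x ≠ j} ≤ η + μ.real (W.tower m)ᶜ := by
  have hA : MeasurableSet {x | W.stage k n x - W.stage k m x ≠ j} :=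
    (((measurable_of_countable fun p : ZMod k × ZMod k => p.1 - p.2).comp
      ((W.measurable_stage k n).prodMk (W.measurable_stage k m)))
        (measurableSet_singleton (j : ZMod k))).compl
  set J := (W.I m n).filter fun i => i % k ≠ j with hJ
  have hb := W.b_pos n
  rw [div_lt_iff₀ (W.card_I_pos hmn.le)] at hj
  have hlev : ∀ a ∈ Finset.range (W.h m),
      μ.real ({x | W.stage k n x - W.stage k m x ≠ j} ∩ W.level m a) ≤ η * W.b m := fun a ha => by
    rw [Finset.mem_range] at ha
    have h1 : μ.real ({x | W.stage k n x - W.stage k m x ≠ j} ∩ W.level m a) ≤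
        μ.real (⋃ i ∈ J, W.level n (i + a)) := by
      refine measureReal_mono_of_ae ?_
      have h2 : ∀ᵐ x ∂μ, ∀ i ∈ W.I m n, x ∈ W.level n (i + a) →
          W.stage k n x = (i + a : ℕ) := by
        refine (Finset.eventually_all _).2 fun i hi => ae_stage_eq k ?_
        have := W.I_add_le m n hmn.le i hi
        omega
      filter_upwards [h2, ae_stage_eq k ha, (W.level_refine hmn.le a).mem_iff] with x h3 h4 h5 h6
      have h7 := h5.1 h6.2
      simp only [mem_iUnion] at h7 ⊢
      obtain ⟨i, hi, hx⟩ := h7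
      refine ⟨i, ?_, hx⟩
      rw [hJ, Finset.mem_filter]
      refine ⟨hi, fun hij => h6.1 ?_⟩
      rw [h3 i hi hx, h4 h6.2, ← hij]
      simp
    have h2 : μ.real (⋃ i ∈ J, W.level n (i + a)) ≤ J.card * W.b n := by
      refine (measureReal_biUnion_finset_le _ _).trans (le_of_eq ?_)
      simp [real_level]
    rw [W.b_eq_card_mul hmn.le, ← mul_assoc]
    exact (h1.trans h2).trans (mul_le_mul_of_nonneg_right hj.le hb.le)
  have h1 := W.real_le_sum_inter_level m hA
  have h2 := Finset.sum_le_sum hlev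
  rw [Finset.sum_const, nsmul_eq_mul, Finset.card_range] at h2
  have h3 := W.h_mul_b_le_one m
  nlinarith

/-- `S` takes each level above the base to the level below it, so the relation can only fail on the
base and off the tower. -/
theorem real_stage_map_ne_le (k n : ℕ) [NeZero k] :
    μ.real {x | W.stage k n (W.S x) + 1 ≠ W.stage k n x} ≤ W.b n + μ.real (W.tower n)ᶜ := by
  have hA : MeasurableSet {x | W.stage k n (W.S x) + 1 ≠ W.stage k n x} :=
    (measurableSet_eq_fun ((measurable_of_countable (· + (1 : ZMod k))).comp
      ((W.measurable_stage k n).comp W.preserving.measurable)) (W.measurable_stage k n)).compl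
  refine (W.real_le_sum_inter_level n hA).trans (add_le_add ?_ le_rfl)
  rw [Finset.sum_eq_single 0]
  · rw [← W.real_level n 0]
    exact measureReal_mono inter_subset_right
  · intro i hi hi0
    rw [Finset.mem_range] at hi
    obtain ⟨i, rfl⟩ := Nat.exists_eq_succ_of_ne_zero hi0
    rw [measureReal_eq_zero_iff, measure_eq_zero_iff_ae_notMem]
    have hi' : i < W.h n := by omega
    filter_upwards [ae_stage_eq k hi, W.preserving.quasiMeasurePreserving.ae (ae_stage_eq k hi')]
      with x h1 h2 h3
    refine h3.1 ?_
    have h4 : W.S x ∈ W.level n i := h3.2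
    rw [h1 h3.2, h2 h4]
    simp
  · intro h0
    exact absurd (Finset.mem_range.2 (W.h_pos n)) h0

/-- If the return times to the bases are asymptotically constant modulo `k`, then there is an
eigenfunction of order `k`. -/
theorem exists_isEigen {k : ℕ} [NeZero k]
    (H : ∀ η : ℝ, 0 < η → ∃ N, ∀ m n, N ≤ m → m < n → ∃ j < k,
      (((W.I m n).filter fun i => i % k ≠ j).card : ℝ) / (W.I m n).card < η) :
    ∃ f, W.IsEigen k f := by
  have hev : ∀ p : ℕ, ∀ᶠ m in Filter.atTop, (∀ n, m < n → ∃ j < k,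
      (((W.I m n).filter fun i => i % k ≠ j).card : ℝ) / (W.I m n).card < (1 / 2 : ℝ) ^ p) ∧
      μ.real (W.tower m)ᶜ < (1 / 2 : ℝ) ^ p ∧ W.b m < (1 / 2 : ℝ) ^ p := fun p => by
    have hp : (0 : ℝ) < (1 / 2 : ℝ) ^ p := by positivity
    obtain ⟨N₁, h₁⟩ := H _ hp
    obtain ⟨N₂, h₂⟩ := W.exists_compl_tower_lt hp
    obtain ⟨N₃, h₃⟩ := W.exists_b_lt hp
    filter_upwards [Filter.eventually_ge_atTop N₁, Filter.eventually_ge_atTop N₂,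
      Filter.eventually_ge_atTop N₃] with m hm1 hm2 hm3
    exact ⟨fun n hn => h₁ m n hm1 hn, h₂ m hm2, h₃ m hm3⟩
  -- Passing to a subsequence makes the errors geometric, hence summable as Borel–Cantelli requires.
  obtain ⟨φ, hφ, hP⟩ := Filter.extraction_forall_of_eventually hev
  choose j _ hj using fun p => (hP p).1 (φ (p + 1)) (hφ p.lt_succ_self)
  -- Subtracting the accumulated typical shifts makes successive functions agree off a small set.
  set g : ℕ → X → ZMod k := fun p x =>
    W.stage k (φ p) x - ∑ q ∈ Finset.range p, (j q : ZMod k) with hg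
  have hgm : ∀ p, Measurable (g p) := fun p =>
    (measurable_of_countable (· - ∑ q ∈ Finset.range p, (j q : ZMod k))).comp
      (W.measurable_stage k (φ p))
  have hsum : Summable fun p : ℕ => 2 * (1 / 2 : ℝ) ^ p :=
    (summable_geometric_of_lt_one (by norm_num) (by norm_num)).mul_left 2
  have hconst : ∀ᵐ x ∂μ, ∀ᶠ p in Filter.atTop, x ∉ {x | g (p + 1) x ≠ g p x} := by
    refine ae_eventually_notMem_of_summable hsum fun p => ?_
    have h1 := real_stage_sub_stage_ne_le k (hφ p.lt_succ_self) (by positivity) (hj p)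
    have h2 := (hP p).2.1
    have h3 : _ ≤ 2 * (1 / 2 : ℝ) ^ p := h1.trans (by linarith)
    refine (measureReal_mono ?_).trans h3
    intro x hx h
    refine hx ?_
    simp only [hg, Finset.sum_range_succ]
    rw [← h]; ring
  have hmap : ∀ᵐ x ∂μ, ∀ᶠ p in Filter.atTop, x ∉ {x | g p (W.S x) + 1 ≠ g p x} := by
    refine ae_eventually_notMem_of_summable hsum fun p => ?_
    have h1 := W.real_stage_map_ne_le k (φ p)
    have h2 := (hP p).2
    have h3 : _ ≤ 2 * (1 / 2 : ℝ) ^ p := h1.trans (by linarith)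
    refine (measureReal_mono ?_).trans h3
    intro x hx h
    refine hx ?_
    simp only [hg]
    rw [← h]; ring
  set G : ZMod k → Set X := fun v => {x | ∀ᶠ p in Filter.atTop, g p x = v} with hG
  have hGm : ∀ v, MeasurableSet (G v) := fun v => by
    have h1 : G v = Filter.liminf (fun p => g p ⁻¹' {v}) Filter.atTop := by
      ext x; rw [Filter.mem_liminf_iff_eventually_mem]; rfl
    rw [h1]
    exact MeasurableSet.measurableSet_liminf fun p => (hgm p) (measurableSet_singleton v)
  -- The eventual value of `g p x`, and zero where there is none; the finite sum of indicators makes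
  -- measurability immediate.
  set f : X → ZMod k := fun x => ∑ v, (G v).indicator (fun _ => v) x with hf
  have hfeq : ∀ x v, (∀ᶠ p in Filter.atTop, g p x = v) → f x = v := fun x v hv => by
    simp only [hf]
    rw [Finset.sum_eq_single v]
    · exact indicator_of_mem (show x ∈ G v from hv) _
    · intro w _ hwv
      refine indicator_of_notMem (fun hw : x ∈ G w => hwv ?_) _
      obtain ⟨p, h1, h2⟩ := (hv.and (show ∀ᶠ p in Filter.atTop, g p x = w from hw)).exists
      rw [← h1, ← h2]
    · intro h; exact absurd (Finset.mem_univ v) h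
  have hlim : ∀ᵐ x ∂μ, ∀ᶠ p in Filter.atTop, g p x = f x := by
    filter_upwards [hconst] with x hx
    obtain ⟨N, hN⟩ := Filter.eventually_atTop.1 hx
    have h1 : ∀ p, N ≤ p → g p x = g N x := fun p hp => by
      induction p, hp using Nat.le_induction with
      | base => rfl
      | succ p hp ih => rw [← ih]; exact not_not.1 (hN p hp)
    have h2 : ∀ᶠ p in Filter.atTop, g p x = g N x := Filter.eventually_atTop.2 ⟨N, h1⟩
    rwa [hfeq x _ h2]
  refine ⟨f, Finset.measurable_sum _ fun v _ => measurable_const.indicator (hGm v), ?_⟩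
  filter_upwards [hlim, W.preserving.quasiMeasurePreserving.ae hlim, hmap] with x h1 h2 h3
  obtain ⟨p, ⟨h4, h5⟩, h6⟩ := ((h1.and h2).and h3).exists
  rw [← h4, ← h5]
  exact not_not.1 h6

end TowerSystem

/-! ### Odometers: divisor sets, cylinders and uniqueness of the measure -/

namespace OdometerSeq

/-- A set of positive integers that is closed under divisors and directed for divisibility is the
set of divisors of an odometer. -/
theorem exists_divisorSet_eq {K : Set ℕ} (h0 : 0 ∉ K) (hdvd : ∀ a ∈ K, ∀ d, d ∣ a → d ∈ K)
    (hdir : ∀ a ∈ K, ∀ b ∈ K, ∃ c ∈ K, a ∣ c ∧ b ∣ c) (h1 : ∃ a ∈ K, 1 < a) :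
    ∃ O : OdometerSeq, O.divisorSet = K := by
  classical
  obtain ⟨a, haK, ha⟩ := h1
  -- Step `n` absorbs `n` if it belongs to `K` and need not change the term otherwise, so each `d ∈
  -- K` divides term `d + 1`.
  have step : ∀ (n : ℕ) (x : K), ∃ y : K, x.1 ∣ y.1 ∧ (n ∈ K → n ∣ y.1) := fun n x => by
    by_cases hn : n ∈ K
    · obtain ⟨c, hc, h1, h2⟩ := hdir x.1 x.2 n hn
      exact ⟨⟨c, hc⟩, h1, fun _ => h2⟩
    · exact ⟨x, dvd_rfl, fun h => absurd h hn⟩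
  choose next hnext hnext' using step
  set u : ℕ → K := fun n => Nat.rec ⟨a, haK⟩ (fun n x => next n x) n with hu
  have hu1 : ∀ n, (u n).1 ∣ (u (n + 1)).1 := fun n => hnext n (u n)
  have hua : ∀ n, a ∣ (u n).1 := fun n => by
    induction n with
    | zero => exact dvd_rfl
    | succ n ih => exact ih.trans (hu1 n)
  refine ⟨⟨fun n => (u n).1, fun n => ?_, hu1⟩, ?_⟩
  · refine lt_of_lt_of_le ha (Nat.le_of_dvd (Nat.pos_of_ne_zero fun h => h0 ?_) (hua n))
    rw [← h]; exact (u n).2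
  · ext d
    constructor
    · rintro ⟨n, hn⟩
      exact hdvd _ (u n).2 d hn
    · intro hd
      exact ⟨d + 1, hnext' d (u d) hd⟩

variable (O : OdometerSeq)

instance neZero_k (n : ℕ) : NeZero (O.k n) := ⟨Nat.pos_iff_ne_zero.1 (O.k_pos n)⟩

/-- The `n`-th coordinate as a residue class. -/
def coord (n : ℕ) (α : O.Space) : ZMod (O.k n) := (α.1 n : ZMod (O.k n))

theorem val_coord (n : ℕ) (α : O.Space) : (O.coord n α).val = α.1 n := by
  rw [coord, ZMod.val_natCast, Nat.mod_eq_of_lt (α.2.1 n)]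

theorem measurable_coord (n : ℕ) : Measurable (O.coord n) :=
  (measurable_of_countable fun i : ℕ => (i : ZMod (O.k n))).comp
    ((measurable_pi_apply n).comp measurable_subtype_coe)

theorem coord_shift (n : ℕ) (α : O.Space) : O.coord n (O.shift α) = O.coord n α + 1 := by
  simp [coord, shift]

theorem castHom_coord {m n : ℕ} (hmn : m ≤ n) (α : O.Space) :
    ZMod.castHom (O.dvd_of_le hmn) (ZMod (O.k m)) (O.coord n α) = O.coord m α := by
  rw [coord, map_natCast, coord, ← α.2.2 m n hmn, ZMod.natCast_mod]

theorem ext_coord {α β : O.Space} (h : ∀ n, O.coord n α = O.coord n β) : α = β :=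
  Subtype.ext (funext fun n => by rw [← O.val_coord, ← O.val_coord, h n])

/-- The sets that depend on a single coordinate. -/
def cylinders : Set (Set O.Space) := {G | ∃ (n : ℕ) (E : Set (ZMod (O.k n))), G = O.coord n ⁻¹' E}

theorem isSetAlgebra_cylinders : IsSetAlgebra O.cylinders where
  empty_mem := ⟨0, ∅, rfl⟩
  compl_mem := by rintro _ ⟨n, E, rfl⟩; exact ⟨n, Eᶜ, rfl⟩
  union_mem := by
    rintro _ _ ⟨m, E, rfl⟩ ⟨n, F, rfl⟩
    refine ⟨max m n, ZMod.castHom (O.dvd_of_le (le_max_left m n)) (ZMod (O.k m)) ⁻¹' E ∪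
      ZMod.castHom (O.dvd_of_le (le_max_right m n)) (ZMod (O.k n)) ⁻¹' F, ?_⟩
    ext α
    rw [mem_union, preimage_union, mem_union, mem_preimage, mem_preimage, mem_preimage,
      mem_preimage, mem_preimage, mem_preimage, O.castHom_coord (le_max_left m n),
      O.castHom_coord (le_max_right m n)]

theorem generateFrom_cylinders :
    (inferInstance : MeasurableSpace O.Space) = MeasurableSpace.generateFrom O.cylinders := by
  refine le_antisymm ?_ (MeasurableSpace.generateFrom_le ?_)
  · refine measurable_iff_comap_le.1 (@measurable_pi_lambda _ _ _ (_) _ _ fun n => ?_)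
    intro t _
    refine MeasurableSpace.measurableSet_generateFrom ⟨n, ZMod.val ⁻¹' t, ?_⟩
    ext α
    simp [val_coord]
  · rintro _ ⟨n, E, rfl⟩
    exact O.measurable_coord n trivial

instance : IsProbabilityMeasure O.measure :=
  Measure.isProbabilityMeasure_map O.measurable_ofDigits.aemeasurable

theorem exists_cylinder_approx {G : Set O.Space} (hG : MeasurableSet G) {δ : ℝ} (hδ : 0 < δ) :
    ∃ (n : ℕ) (E : Set (ZMod (O.k n))), O.measure.real (symmDiff G (O.coord n ⁻¹' E)) < δ := by
  have h := Measure.MeasureDense.of_generateFrom_isSetAlgebra_finite (μ := O.measure)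
    O.isSetAlgebra_cylinders O.generateFrom_cylinders
  obtain ⟨_, ⟨n, E, rfl⟩, hlt⟩ := h.approx G hG (measure_ne_top _ _) δ hδ
  exact ⟨n, E, (ENNReal.lt_ofReal_iff_toReal_lt (measure_ne_top _ _)).1 hlt⟩

theorem measure_coord (n : ℕ) (c : ZMod (O.k n)) :
    O.measure (O.coord n ⁻¹' {c}) = (O.k n : ENNReal)⁻¹ := by
  rw [← O.measure_cylinder n c.val (ZMod.val_lt c)]
  congr 1
  ext α
  change O.coord n α = c ↔ α.1 n = c.val
  rw [← val_coord, (ZMod.val_injective _).eq_iff]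

/-- Cylinders form an algebra, hence a π-system, that generates the σ-algebra. -/
theorem eq_measure {ν : Measure O.Space} [IsFiniteMeasure ν]
    (h : ∀ n c, ν (O.coord n ⁻¹' {c}) = (O.k n : ENNReal)⁻¹) : ν = O.measure := by
  have key : ∀ n, ν.map (O.coord n) = O.measure.map (O.coord n) := fun n => by
    refine Measure.ext_of_singleton fun c => ?_
    rw [Measure.map_apply (O.measurable_coord n) (measurableSet_singleton c),
      Measure.map_apply (O.measurable_coord n) (measurableSet_singleton c), h, measure_coord]
  have hcyl : ∀ G ∈ O.cylinders, ν G = O.measure G := by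
    rintro _ ⟨n, E, rfl⟩
    rw [← Measure.map_apply (O.measurable_coord n) trivial,
      ← Measure.map_apply (O.measurable_coord n) trivial, key]
  refine ext_of_generate_finite _ O.generateFrom_cylinders ?_ hcyl
    (hcyl _ O.isSetAlgebra_cylinders.univ_mem)
  intro s hs t ht _
  exact O.isSetAlgebra_cylinders.inter_mem hs ht

/-- The point of the odometer given by a coherent sequence of residue classes. -/
def ofCoherent (a : ∀ n, ZMod (O.k n))
    (h : ∀ n, ZMod.castHom (O.dvd_succ n) (ZMod (O.k n)) (a (n + 1)) = a n) : O.Space :=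
  ⟨fun n => (a n).val, fun n => ZMod.val_lt _, fun m n hmn => by
    induction n, hmn using Nat.le_induction with
    | base => exact Nat.mod_eq_of_lt (ZMod.val_lt _)
    | succ n hmn ih =>
      rw [← ih]
      change (a (n + 1)).val % O.k m = (a n).val % O.k m
      rw [← h n, ZMod.castHom_apply, ZMod.cast_eq_val, ZMod.val_natCast,
        Nat.mod_mod_of_dvd _ (O.dvd_of_le hmn)]⟩

theorem coord_ofCoherent (a : ∀ n, ZMod (O.k n))
    (h : ∀ n, ZMod.castHom (O.dvd_succ n) (ZMod (O.k n)) (a (n + 1)) = a n) (n : ℕ) :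
    O.coord n (O.ofCoherent a h) = a n := by
  simp [coord, ofCoherent]

theorem measurable_of_coord {X : Type*} [MeasurableSpace X] {Φ : X → O.Space}
    (h : ∀ n, Measurable fun x => O.coord n (Φ x)) : Measurable Φ := by
  have h1 : Φ = fun x => ⟨(Φ x).1, (Φ x).2⟩ := rfl
  rw [h1]
  refine Measurable.subtype_mk (measurable_pi_lambda _ fun n => ?_)
  simp only [← val_coord]
  exact (measurable_of_countable ZMod.val).comp (h n)

/-- Countably many coordinates separate points. This makes the set where a map agrees with the
identity measurable, as is needed for the right inverse in `exists_isInvertibleMod0`. -/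
instance : MeasurableEq O.Space where
  measurableSet_diagonal := by
    have h : diagonal O.Space = ⋂ n, {p | O.coord n p.1 = O.coord n p.2} := by
      ext p
      rw [mem_diagonal_iff, mem_iInter]
      exact ⟨fun h n => congrArg (O.coord n) h, O.ext_coord⟩
    rw [h]
    exact MeasurableSet.iInter fun n => measurableSet_eq_fun
      ((O.measurable_coord n).comp measurable_fst) ((O.measurable_coord n).comp measurable_snd)

end OdometerSeq

/-! ### Coherent eigenfunctions and the factor map onto an odometer -/

namespace TowerSystem

variable {X : Type*} [MeasurableSpace X] {μ : Measure X} [IsProbabilityMeasure μ]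
  {W : TowerSystem μ}

/-- An eigenfunction can be lifted to one whose order is a multiple, if there is any of that
order. -/
theorem IsEigen.exists_lift {d k : ℕ} [NeZero d] [NeZero k] (hd : d ∣ k) {f : X → ZMod d}
    {g : X → ZMod k} (hf : W.IsEigen d f) (hg : W.IsEigen k g) :
    ∃ g', W.IsEigen k g' ∧ ∀ᵐ x ∂μ, ZMod.castHom hd (ZMod d) (g' x) = f x := by
  obtain ⟨c, hc⟩ := (hg.cast hd).exists_eq_add hf
  refine ⟨_, hg.add_const (c.val : ZMod k), ?_⟩
  filter_upwards [hc] with x hx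
  rw [hx, map_add, map_natCast, ZMod.natCast_zmod_val]

theorem IsEigen.congr {k : ℕ} {f g : X → ZMod k} (hf : W.IsEigen k f) (hg : Measurable g)
    (hfg : f =ᵐ[μ] g) : W.IsEigen k g where
  measurable := hg
  map_add_one := by
    filter_upwards [hf.map_add_one, hfg, W.preserving.quasiMeasurePreserving.ae hfg]
      with x h1 h2 h3
    rw [← h2, ← h3, h1]

/-- Eigenfunctions for all terms of an odometer sequence combine to a factor map. -/
theorem exists_factor (O : OdometerSeq) (h : ∀ n, ∃ f, W.IsEigen (O.k n) f) :
    ∃ Φ : X → O.Space, Measurable Φ ∧ ∀ n, W.IsEigen (O.k n) fun x => O.coord n (Φ x) := by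
  classical
  choose g hg using h
  choose lift hlift hcast using fun (n : ℕ) (f : {f // W.IsEigen (O.k n) f}) =>
    f.2.exists_lift (O.dvd_succ n) (hg (n + 1))
  -- Each eigenfunction is chosen as a lift of the previous one, so that the sequence is coherent
  -- almost everywhere.
  set F : ∀ n, {f // W.IsEigen (O.k n) f} := fun n =>
    Nat.rec ⟨g 0, hg 0⟩ (fun n f => ⟨lift n f, hlift n f⟩) n with hF
  have hcoh : ∀ n, ∀ᵐ x ∂μ,
      ZMod.castHom (O.dvd_succ n) (ZMod (O.k n)) ((F (n + 1)).1 x) = (F n).1 x :=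
    fun n => hcast n (F n)
  set Z : Set X := ⋂ n, {x | ZMod.castHom (O.dvd_succ n) (ZMod (O.k n)) ((F (n + 1)).1 x)
    = (F n).1 x} with hZ
  have hZm : MeasurableSet Z := MeasurableSet.iInter fun n => measurableSet_eq_fun
    ((measurable_of_countable _).comp (F (n + 1)).2.measurable) (F n).2.measurable
  have hZae : ∀ᵐ x ∂μ, x ∈ Z := by
    filter_upwards [ae_all_iff.2 hcoh] with x hx
    exact mem_iInter.2 hx
  -- The value zero off `Z` makes the sequence coherent at every point, as a map into `O.Space`
  -- requires.
  set a : ∀ n, X → ZMod (O.k n) := fun n => Z.indicator (F n).1 with ha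
  have ham : ∀ n, Measurable (a n) := fun n => (F n).2.measurable.indicator hZm
  have hae : ∀ n, (F n).1 =ᵐ[μ] a n := fun n => by
    filter_upwards [hZae] with x hx
    exact (indicator_of_mem hx _).symm
  have hac : ∀ x n, ZMod.castHom (O.dvd_succ n) (ZMod (O.k n)) (a (n + 1) x) = a n x :=
    fun x n => by
      by_cases hx : x ∈ Z
      · simp only [ha, indicator_of_mem hx]
        exact mem_iInter.1 hx n
      · simp only [ha, indicator_of_notMem hx, map_zero]
  refine ⟨fun x => O.ofCoherent (fun n => a n x) (hac x), O.measurable_of_coord fun n => ?_,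
    fun n => ?_⟩
  · simpa only [OdometerSeq.coord_ofCoherent] using ham n
  · simpa only [OdometerSeq.coord_ofCoherent] using (F n).2.congr (ham n) (hae n)

end TowerSystem

/-! ### Maps modulo null sets and invertibility of factor maps -/

namespace IsMeasurePreservingMod0

variable {X Y : Type*} [MeasurableSpace X] [MeasurableSpace Y] {μ : Measure X} {ν : Measure Y}
  {φ : X → Y}

theorem measure_preimage_null (hφ : IsMeasurePreservingMod0 μ ν φ) {A : Set Y} (hA : ν A = 0) :
    μ (φ ⁻¹' A) = 0 := by
  refine measure_mono_null (preimage_mono (subset_toMeasurable ν A)) ?_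
  rw [(hφ _ (measurableSet_toMeasurable ν A)).2, measure_toMeasurable, hA]

theorem ae (hφ : IsMeasurePreservingMod0 μ ν φ) {p : Y → Prop} (hp : ∀ᵐ y ∂ν, p y) :
    ∀ᵐ x ∂μ, p (φ x) := hφ.measure_preimage_null hp

theorem preimage_ae_eq (hφ : IsMeasurePreservingMod0 μ ν φ) {A A' : Set Y} (h : A =ᵐ[ν] A') :
    φ ⁻¹' A =ᵐ[μ] φ ⁻¹' A' := hφ.ae h

theorem nullMeasurableSet_preimage (hφ : IsMeasurePreservingMod0 μ ν φ) {A : Set Y}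
    (hA : NullMeasurableSet A ν) : NullMeasurableSet (φ ⁻¹' A) μ := by
  obtain ⟨A', -, h1, h2⟩ := hA.exists_measurable_superset_ae_eq
  exact (hφ A' h1).1.congr (hφ.preimage_ae_eq h2)

theorem measure_preimage (hφ : IsMeasurePreservingMod0 μ ν φ) {A : Set Y}
    (hA : NullMeasurableSet A ν) : μ (φ ⁻¹' A) = ν A := by
  obtain ⟨A', -, h1, h2⟩ := hA.exists_measurable_superset_ae_eq
  rw [← measure_congr h2, ← (hφ A' h1).2, measure_congr (hφ.preimage_ae_eq h2)]

/-- A map preserving the measure modulo null sets is measure-preserving for the completed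
measures. -/
theorem completion (hφ : IsMeasurePreservingMod0 μ ν φ) :
    @MeasurePreserving (NullMeasurableSpace X μ) (NullMeasurableSpace Y ν) _ _ φ
      μ.completion ν.completion := by
  have hm : @Measurable (NullMeasurableSpace X μ) (NullMeasurableSpace Y ν) _ _ φ :=
    fun A hA => hφ.nullMeasurableSet_preimage hA
  refine ⟨hm, Measure.ext fun A hA => ?_⟩
  rw [Measure.map_apply hm hA]
  exact hφ.measure_preimage hA

end IsMeasurePreservingMod0

theorem IsStandardLebesgue.isProbabilityMeasure {X : Type*} [MeasurableSpace X] {μ : Measure X}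
    (hμ : IsStandardLebesgue μ) : IsProbabilityMeasure μ := by
  obtain ⟨φ, ψ, h⟩ := hμ
  refine ⟨?_⟩
  have := (h.map_preserving univ MeasurableSet.univ).2
  rw [preimage_univ] at this
  rw [this]; simp

section Inverse

variable {X Y : Type*} [MeasurableSpace X] [MeasurableSpace Y] {μ : Measure X} {ν : Measure Y}
  {Φ : X → Y}

/-- A set that is approximated by preimages of measurable sets is such a preimage modulo null
sets. -/
theorem exists_ae_eq_preimage_of_approx [IsFiniteMeasure μ] {A : Set X}
    (h : ∀ ε : ℝ, 0 < ε → ∃ A', MeasurableSet A' ∧ μ.real (symmDiff A (Φ ⁻¹' A')) < ε) :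
    ∃ A', MeasurableSet A' ∧ A =ᵐ[μ] Φ ⁻¹' A' := by
  choose G hGm hG using fun p : ℕ => h ((1 / 2 : ℝ) ^ p) (by positivity)
  -- By Borel–Cantelli almost every point is misclassified by only finitely many `G p`.
  refine ⟨Filter.liminf G Filter.atTop, MeasurableSet.measurableSet_liminf hGm, ?_⟩
  have h1 : ∀ᵐ x ∂μ, ∀ᶠ p in Filter.atTop, x ∉ symmDiff A (Φ ⁻¹' G p) :=
    ae_eventually_notMem_of_summable
      (summable_geometric_of_lt_one (by norm_num) (by norm_num)) fun p => (hG p).le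
  filter_upwards [h1] with x hx
  have h2 : ∀ᶠ p in Filter.atTop, (x ∈ A ↔ Φ x ∈ G p) := by
    filter_upwards [hx] with p hp
    rw [mem_symmDiff] at hp
    change ¬(x ∈ A ∧ Φ x ∉ G p ∨ Φ x ∈ G p ∧ x ∉ A) at hp
    tauto
  apply propext
  change x ∈ A ↔ Φ x ∈ Filter.liminf G Filter.atTop
  rw [Filter.mem_liminf_iff_eventually_mem]
  constructor
  · intro hxA
    filter_upwards [h2] with p hp using hp.1 hxA
  · intro hev
    obtain ⟨p, hp1, hp2⟩ := (h2.and hev).exists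
    exact hp1.2 hp2

/-- A real function whose sublevel sets are preimages under `Φ` modulo null sets factors through
`Φ`. -/
theorem exists_measurable_factor {u : X → ℝ}
    (h : ∀ q : ℚ, ∃ A', MeasurableSet A' ∧ u ⁻¹' Iio (q : ℝ) =ᵐ[μ] Φ ⁻¹' A') :
    ∃ g : Y → ℝ, Measurable g ∧ ∀ᵐ x ∂μ, g (Φ x) = u x := by
  classical
  choose A' hA' hae using h
  -- The value of `u` is recovered as the infimum of the rationals above it; `EReal` keeps this
  -- infimum defined for every `y`.
  refine ⟨fun y => (⨅ q : ℚ, if y ∈ A' q then ((q : ℝ) : EReal) else ⊤).toReal, ?_, ?_⟩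
  · refine Measurable.ereal_toReal (Measurable.iInf fun q => ?_)
    exact Measurable.ite (hA' q) measurable_const measurable_const
  · filter_upwards [ae_all_iff.2 fun q => (hae q).mem_iff] with x hx
    have h1 : (⨅ q : ℚ, if Φ x ∈ A' q then ((q : ℝ) : EReal) else ⊤) = (u x : EReal) := by
      refine le_antisymm ?_ (le_iInf fun q => ?_)
      · refine EReal.le_of_forall_lt_iff_le.1 fun z hz => ?_
        obtain ⟨q, hq1, hq2⟩ := exists_rat_btwn (EReal.coe_lt_coe_iff.1 hz)
        refine (iInf_le _ q).trans ?_
        rw [if_pos (show Φ x ∈ A' q from (hx q).1 hq1)]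
        exact EReal.coe_le_coe_iff.2 hq2.le
      · split_ifs with hq
        · exact EReal.coe_le_coe_iff.2 (show u x < q from (hx q).2 hq).le
        · exact le_top
    rw [h1, EReal.toReal_coe]

/-- A measure-preserving map defined on a standard Lebesgue space is invertible modulo null sets
if the preimages of measurable sets approximate every measurable set. -/
theorem exists_isInvertibleMod0 [MeasurableEq Y] (hμ : IsStandardLebesgue μ)
    (hΦ : IsMeasurePreservingMod0 μ ν Φ)
    (hgen : ∀ A, MeasurableSet A → ∀ ε : ℝ, 0 < ε →
      ∃ A', MeasurableSet A' ∧ μ.real (symmDiff A (Φ ⁻¹' A')) < ε) :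
    ∃ ψ : Y → X, IsInvertibleMod0 μ ν Φ ψ := by
  have := hμ.isProbabilityMeasure
  obtain ⟨φ₀, ψ₀, h₀⟩ := hμ
  -- The chart to the unit interval factors through `Φ`; composing with the inverse chart then gives
  -- the inverse of `Φ`.
  obtain ⟨g, hgm, hg⟩ : ∃ g : Y → ℝ, Measurable g ∧ ∀ᵐ x ∂μ, g (Φ x) = φ₀ x := by
    refine exists_measurable_factor fun q => ?_
    obtain ⟨A, -, hAm, hA⟩ := (h₀.map_preserving (Iio (q : ℝ))
      measurableSet_Iio).1.exists_measurable_superset_ae_eq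
    obtain ⟨A', hA', h'⟩ := exists_ae_eq_preimage_of_approx (hgen A hAm)
    exact ⟨A', hA', hA.symm.trans h'⟩
  have hgp : MeasurePreserving g ν (volume.restrict (Icc (0 : ℝ) 1)) := by
    refine ⟨hgm, Measure.ext fun C hC => ?_⟩
    rw [Measure.map_apply hgm hC, ← (hΦ _ (hgm hC)).2, ← (h₀.map_preserving C hC).2]
    refine measure_congr ?_
    filter_upwards [hg] with x hx
    apply propext
    change g (Φ x) ∈ C ↔ φ₀ x ∈ C
    rw [hx]
  have hψ : IsMeasurePreservingMod0 ν μ (ψ₀ ∘ g) := fun A hA => by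
    obtain ⟨h1, h2⟩ := h₀.inv_preserving A hA
    rw [preimage_comp]
    exact ⟨h1.preimage hgp.quasiMeasurePreserving, by rw [hgp.measure_preimage h1, h2]⟩
  have hleft : ∀ᵐ x ∂μ, (ψ₀ ∘ g) (Φ x) = x := by
    filter_upwards [hg, h₀.left_inv] with x h1 h2
    rw [Function.comp_apply, h1, h2]
  refine ⟨ψ₀ ∘ g, hΦ, hψ, hleft, ?_⟩
  have hF : @Measurable (NullMeasurableSpace Y ν) Y _ _ fun y => Φ ((ψ₀ ∘ g) y) := fun A hA =>
    hψ.nullMeasurableSet_preimage (hΦ A hA).1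
  have hid : @Measurable (NullMeasurableSpace Y ν) Y _ _ fun y => y := fun A hA =>
    MeasurableSet.nullMeasurableSet hA
  have hZ : NullMeasurableSet {y | Φ ((ψ₀ ∘ g) y) = y}ᶜ ν :=
    (measurableSet_eq_fun hF hid).compl
  change ν {y | Φ ((ψ₀ ∘ g) y) = y}ᶜ = 0
  -- Failure of the right inverse is pulled back along `Φ`, where the left inverse excludes it.
  rw [← hΦ.measure_preimage hZ, measure_eq_zero_iff_ae_notMem]
  filter_upwards [hleft] with x hx h
  exact h (congrArg Φ hx)

end Inverse

theorem IsMeasurePreservingMod0.iterate {X : Type*} [MeasurableSpace X] {μ : Measure X}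
    {φ : X → X} (hφ : IsMeasurePreservingMod0 μ μ φ) (i : ℕ) :
    IsMeasurePreservingMod0 μ μ φ^[i] := by
  induction i with
  | zero => exact fun A hA => ⟨hA.nullMeasurableSet, rfl⟩
  | succ i ih =>
    intro A hA
    rw [Function.iterate_succ, preimage_comp]
    obtain ⟨h1, h2⟩ := ih A hA
    exact ⟨hφ.nullMeasurableSet_preimage h1, by rw [hφ.measure_preimage h1, h2]⟩

namespace Transformation

variable {X : Type*} [MeasurableSpace X] {μ : Measure X} (T : Transformation μ)

theorem image_congr (i : ℕ) {A A' : Set X} (h : A =ᵐ[μ] A') : T.image i A =ᵐ[μ] T.image i A' :=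
  (T.invertible.inv_preserving.iterate i).preimage_ae_eq h

theorem image_image (i j : ℕ) (A : Set X) : T.image i (T.image j A) = T.image (j + i) A := by
  rw [image, image, image, ← preimage_comp, ← Function.iterate_add]

theorem image_biUnion (i : ℕ) {ι : Type*} (D : Finset ι) (A : ι → Set X) :
    T.image i (⋃ j ∈ D, A j) = ⋃ j ∈ D, T.image i (A j) := by
  simp only [image, preimage_iUnion]

end Transformation

/-! ### The towers of a rank-one construction -/

namespace RankOneConstruction

variable {X : Type*} [MeasurableSpace X] {μ : Measure X} {T : Transformation μ}
  (R : RankOneConstruction T)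

/-- The index, in the tower of stage `n + 1`, of the bottom level of the `j`-th copy of the
stage-`n` tower. -/
def offset (n j : ℕ) : ℕ := ∑ i ∈ Finset.range j, (R.h n + R.s n (i + 1))

theorem offset_succ (n j : ℕ) : R.offset n (j + 1) = R.offset n j + (R.h n + R.s n (j + 1)) :=
  Finset.sum_range_succ _ _

theorem offset_r (n : ℕ) : R.offset n (R.r n) = R.h (n + 1) := by
  change _ = R.r n * R.h n + ∑ i ∈ Finset.Icc 1 (R.r n), R.s n i
  rw [offset, Finset.sum_add_distrib, Finset.sum_const, Finset.card_range, smul_eq_mul,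
    Finset.range_eq_Ico, Finset.sum_Ico_add' (fun i => R.s n i) 0 (R.r n) 1, zero_add]
  rfl

theorem offset_add_le {n j : ℕ} (hj : j < R.r n) : R.offset n j + R.h n ≤ R.h (n + 1) := by
  have h1 : R.offset n (j + 1) ≤ R.offset n (R.r n) :=
    Finset.sum_le_sum_of_subset (Finset.range_mono hj)
  rw [offset_succ, offset_r] at h1
  omega

theorem two_pow_le_h (n : ℕ) : 2 ^ n ≤ R.h n := by
  induction n with
  | zero => exact le_rfl
  | succ n ih =>
    have h1 := R.one_lt_r n
    calc 2 ^ (n + 1) = 2 * 2 ^ n := by ring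
      _ ≤ R.r n * R.h n := Nat.mul_le_mul h1 ih
      _ ≤ R.h (n + 1) := Nat.le_add_right _ _

theorem spacer_ae_eq {n i j : ℕ} (hi : 0 < i) (hir : i ≤ R.r n) (hj : j < R.s n i) :
    R.C n i (j + 1) =ᵐ[μ] T.image (R.h n + j) (R.B' n i) := by
  induction j with
  | zero => exact (R.top_to_spacer n i hi hir (by omega)).symm
  | succ j ih =>
    have h1 := R.spacer_to_spacer n i (j + 1) hi hir (by omega) hj
    have h2 := T.image_congr 1 (ih (by omega))
    rw [T.image_image] at h2
    exact h1.symm.trans h2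

theorem next_piece_ae_eq {n i : ℕ} (hi : 0 < i) (hir : i < R.r n) :
    R.B' n (i + 1) =ᵐ[μ] T.image (R.h n + R.s n i) (R.B' n i) := by
  rcases Nat.eq_zero_or_pos (R.s n i) with hs | hs
  · rw [hs]
    exact (R.top_to_piece n i hi hir hs).symm
  · have h1 := R.spacer_to_piece n i hi hir hs.ne'
    obtain ⟨j, hj⟩ := Nat.exists_eq_succ_of_ne_zero hs.ne'
    have h2 := T.image_congr 1 (R.spacer_ae_eq hi hir.le (show j < R.s n i by omega))
    rw [T.image_image] at h2
    rw [hj] at h1 ⊢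
    exact h1.symm.trans h2

theorem piece_ae_eq {n j : ℕ} (hj : j < R.r n) :
    R.B' n (j + 1) =ᵐ[μ] T.image (R.offset n j) (R.B (n + 1)) := by
  induction j with
  | zero => exact (R.base_succ n).symm
  | succ j ih =>
    have h1 := R.next_piece_ae_eq (show 0 < j + 1 by omega) hj
    have h2 := T.image_congr (R.h n + R.s n (j + 1)) (ih (by omega))
    rw [T.image_image, ← offset_succ] at h2
    exact h1.trans h2

theorem base_ae_eq (n : ℕ) :
    R.B n =ᵐ[μ] ⋃ j ∈ Finset.range (R.r n), T.image (R.offset n j) (R.B (n + 1)) := by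
  have h1 : (⋃ i ∈ Finset.Icc 1 (R.r n), R.B' n i) =
      ⋃ j ∈ Finset.range (R.r n), R.B' n (j + 1) := by
    ext x
    simp only [mem_iUnion, Finset.mem_Icc, Finset.mem_range, exists_prop]
    constructor
    · rintro ⟨i, ⟨hi, hir⟩, hx⟩
      exact ⟨i - 1, by omega, by rwa [Nat.sub_add_cancel hi]⟩
    · rintro ⟨j, hj, hx⟩
      exact ⟨j + 1, ⟨by omega, hj⟩, hx⟩
  refine (R.pieces_union n).symm.trans ?_
  rw [h1]
  exact Finset.eventuallyEq_iUnion _ fun j hj => R.piece_ae_eq (Finset.mem_range.1 hj)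

/-- The bound records that the whole copy of the stage-`m` tower above index `i`, not only its base,
fits into the stage-`n` tower. -/
theorem exists_refine_base {m n : ℕ} (hmn : m ≤ n) : ∃ J : Finset ℕ,
    (∀ i ∈ J, i + R.h m ≤ R.h n) ∧ R.B m =ᵐ[μ] ⋃ i ∈ J, T.image i (R.B n) := by
  induction n, hmn using Nat.le_induction with
  | base =>
    refine ⟨{0}, by simp, ?_⟩
    simp only [Finset.mem_singleton, iUnion_iUnion_eq_left]
    exact Filter.EventuallyEq.rfl
  | succ n hmn ih =>
    obtain ⟨J, hJ, hB⟩ := ih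
    refine ⟨J.biUnion fun i => (Finset.range (R.r n)).image fun j => R.offset n j + i, ?_, ?_⟩
    · intro a ha
      simp only [Finset.mem_biUnion, Finset.mem_image, Finset.mem_range] at ha
      obtain ⟨i, hi, j, hj, rfl⟩ := ha
      have := hJ i hi
      have := R.offset_add_le hj
      omega
    · have h1 : (⋃ a ∈ J.biUnion fun i => (Finset.range (R.r n)).image fun j => R.offset n j + i,
          T.image a (R.B (n + 1))) = ⋃ i ∈ J, T.image i
            (⋃ j ∈ Finset.range (R.r n), T.image (R.offset n j) (R.B (n + 1))) := by
        simp only [T.image_biUnion, T.image_image]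
        ext x
        simp only [mem_iUnion, Finset.mem_biUnion, Finset.mem_image, exists_prop]
        constructor
        · rintro ⟨_, ⟨i, hi, j, hj, rfl⟩, hx⟩
          exact ⟨i, hi, j, hj, hx⟩
        · rintro ⟨i, hi, j, hj, hx⟩
          exact ⟨_, ⟨i, hi, j, hj, rfl⟩, hx⟩
      rw [h1]
      exact hB.trans (Finset.eventuallyEq_iUnion _ fun i _ => T.image_congr i (R.base_ae_eq n))

theorem measure_image (i n : ℕ) : μ (T.image i (R.B n)) = μ (R.B n) :=
  (T.invertible.inv_preserving.iterate i).measure_preimage (R.measurable_B n)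

/-- One null base would make all null: earlier bases are finite unions of its images and later ones
are contained in it. Then no union of levels could approximate the whole space. -/
theorem measure_base_ne_zero [IsProbabilityMeasure μ] (n : ℕ) : μ (R.B n) ≠ 0 := by
  intro h0
  have hle : ∀ m, m ≤ n → μ (R.B m) = 0 := fun m hm => by
    obtain ⟨J, -, hJ⟩ := R.exists_refine_base hm
    rw [measure_congr hJ]
    exact (measure_biUnion_null_iff J.countable_toSet).2 fun i _ => by
      rw [measure_image, h0]
  have hge : ∀ m, n ≤ m → μ (R.B m) = 0 := fun m hm => by
    induction m, hm using Nat.le_induction with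
    | base => exact h0
    | succ m _ ih =>
      refine measure_mono_null_ae ?_ ih
      refine Filter.EventuallyLE.trans ?_ (R.base_ae_eq m).symm.le
      refine LE.le.eventuallyLE fun x hx => ?_
      exact mem_biUnion (t := fun j => T.image (R.offset m j) (R.B (m + 1)))
        (Finset.mem_range.2 (by have := R.one_lt_r m; omega : 0 < R.r m)) hx
  obtain ⟨m, D, -, hlt⟩ := R.dense univ MeasurableSet.univ 1 one_pos
  have h1 : μ (⋃ i ∈ D, T.image i (R.B m)) = 0 :=
    (measure_biUnion_null_iff D.countable_toSet).2 fun i _ => by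
      rw [measure_image]
      exact (le_total m n).elim (hle m) (hge m)
  have h2 : (1 : ENNReal) ≤ μ (symmDiff univ (⋃ i ∈ D, T.image i (R.B m))) := by
    rw [← measure_univ (μ := μ)]
    refine (measure_mono (t := symmDiff univ (⋃ i ∈ D, T.image i (R.B m)) ∪
      ⋃ i ∈ D, T.image i (R.B m)) fun x _ => ?_).trans ((measure_union_le _ _).trans ?_)
    · by_cases hx : x ∈ ⋃ i ∈ D, T.image i (R.B m)
      · exact Or.inr hx
      · exact Or.inl (Or.inl ⟨mem_univ x, hx⟩)
    · rw [h1, add_zero]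
  exact absurd hlt (not_lt.2 h2)

/-- A level outside `J` is disjoint from `B m` and not null, so it cannot also be contained in `B
m`. -/
theorem eq_I [IsProbabilityMeasure μ] {m n : ℕ} {J : Finset ℕ}
    (hJ : ∀ i ∈ J, i + R.h m ≤ R.h n) (hB : R.B m =ᵐ[μ] ⋃ i ∈ J, T.image i (R.B n)) :
    R.I m n = J := by
  have hJn : ∀ i ∈ J, i < R.h n := fun i hi => by
    have := hJ i hi
    have := lt_of_lt_of_le (show 0 < 2 ^ m by positivity) (R.two_pow_le_h m)
    omega
  ext i
  simp only [I, Finset.mem_filter, Finset.mem_range]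
  constructor
  · rintro ⟨hin, hi⟩
    by_contra hiJ
    refine R.measure_base_ne_zero n ?_
    rw [← R.measure_image i n]
    have h1 : AEDisjoint μ (T.image i (R.B n)) (⋃ j ∈ J, T.image j (R.B n)) := by
      rw [AEDisjoint, inter_iUnion₂]
      refine (measure_biUnion_null_iff J.countable_toSet).2 fun j hj => ?_
      exact R.levels_disjoint n i j hin (hJn j hj) fun h => hiJ (h ▸ hj)
    rw [AEDisjoint, measure_eq_zero_iff_ae_notMem] at h1
    rw [measure_eq_zero_iff_ae_notMem]
    filter_upwards [h1, hi, hB.mem_iff] with x h2 h3 h4 h5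
    exact h2 ⟨h5, h4.1 (h3 h5)⟩
  · intro hi
    refine ⟨hJn i hi, Filter.EventuallyLE.trans ?_ hB.symm.le⟩
    exact LE.le.eventuallyLE (subset_biUnion_of_mem (u := fun i => T.image i (R.B n)) hi)

theorem I_spec [IsProbabilityMeasure μ] {m n : ℕ} (hmn : m ≤ n) :
    (∀ i ∈ R.I m n, i + R.h m ≤ R.h n) ∧ R.B m =ᵐ[μ] ⋃ i ∈ R.I m n, T.image i (R.B n) := by
  obtain ⟨J, hJ, hB⟩ := R.exists_refine_base hmn
  rw [R.eq_I hJ hB]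
  exact ⟨hJ, hB⟩

instance isProbabilityMeasure_completion [IsProbabilityMeasure μ] :
    IsProbabilityMeasure μ.completion := ⟨measure_univ (μ := μ)⟩

/-- The towers of a rank-one construction, for the completed measure. -/
noncomputable def towers [IsProbabilityMeasure μ] : TowerSystem μ.completion where
  S := T.invFun
  preserving := T.invertible.inv_preserving.completion
  B := R.B
  measurableSet_base := R.measurable_B
  base_ne_zero := R.measure_base_ne_zero
  h := R.h
  two_pow_le := R.two_pow_le_h
  I := R.I
  I_add_le _ _ hmn := (R.I_spec hmn).1
  refine_base _ _ hmn := (R.I_spec hmn).2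
  levels_disjoint := R.levels_disjoint
  dense A hA ε hε := by
    obtain ⟨A', -, hA', hae⟩ := NullMeasurableSet.exists_measurable_superset_ae_eq hA
    obtain ⟨n, D, hD, hlt⟩ := R.dense A' hA' (ENNReal.ofReal ε) (ENNReal.ofReal_pos.2 hε)
    refine ⟨n, D, hD, ?_⟩
    have h1 : μ (symmDiff A (⋃ i ∈ D, T.image i (R.B n))) < ENNReal.ofReal ε := by
      refine lt_of_eq_of_lt (measure_congr ?_) hlt
      exact hae.symm.symmDiff Filter.EventuallyEq.rfl
    exact (ENNReal.lt_ofReal_iff_toReal_lt (measure_ne_top _ _)).1 h1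

end RankOneConstruction

/-! ### From approximating bases to approximating all measurable sets -/

namespace TowerSystem

variable {X : Type*} [MeasurableSpace X] {μ : Measure X} [IsProbabilityMeasure μ]
  {W : TowerSystem μ}

theorem IsEigen.preimage_iterate {k : ℕ} {f : X → ZMod k} (hf : W.IsEigen k f) (i : ℕ)
    (E : Set (ZMod k)) : W.S^[i] ⁻¹' (f ⁻¹' E) =ᵐ[μ] {x | f x - i ∈ E} := by
  filter_upwards [hf.iterate i] with x hx
  apply propext
  change f (W.S^[i] x) ∈ E ↔ f x - i ∈ E
  rw [← hx, add_sub_cancel_right]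

/-- If the bases are approximated by unions of fibres of eigenfunctions that factor through `Φ`,
then all measurable sets are approximated by preimages under `Φ`. -/
theorem exists_preimage_approx {Y : Type*} [MeasurableSpace Y] {Φ : X → Y}
    (H : ∀ (l : ℕ) (δ : ℝ), 0 < δ → ∃ (k : ℕ) (u : Y → ZMod k) (E : Set (ZMod k)), Measurable u ∧
      W.IsEigen k (fun x => u (Φ x)) ∧
      μ.real (symmDiff (W.B l) ((fun x => u (Φ x)) ⁻¹' E)) < δ)
    {A : Set X} (hA : MeasurableSet A) {ε : ℝ} (hε : 0 < ε) :
    ∃ A', MeasurableSet A' ∧ μ.real (symmDiff A (Φ ⁻¹' A')) < ε := by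
  obtain ⟨n, D, -, hlt⟩ := W.dense A hA (ε / 2) (by positivity)
  have hδ : 0 < ε / (2 * (D.card + 1)) := by positivity
  have hlev : ∀ i : ℕ, ∃ G : Set Y, MeasurableSet G ∧
      μ.real (symmDiff (W.S^[i] ⁻¹' W.B n) (Φ ⁻¹' G)) < ε / (2 * (D.card + 1)) := fun i => by
    obtain ⟨k, u, E, hu, hf, hE⟩ := H n _ hδ
    -- Level `i` is a preimage of the base under `S^[i]`, which turns fibres into translated fibres
    -- and keeps the error.
    refine ⟨u ⁻¹' {e | e - i ∈ E}, hu trivial, lt_of_eq_of_lt ?_ hE⟩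
    rw [← (W.preserving.iterate i).measureReal_preimage
      ((W.measurableSet_base n).symmDiff (hf.measurableSet E)).nullMeasurableSet]
    refine measureReal_congr ?_
    exact Filter.EventuallyEq.rfl.symmDiff (hf.preimage_iterate i E).symm
  choose G hGm hG using hlev
  refine ⟨⋃ i ∈ D, G i, Finset.measurableSet_biUnion _ fun i _ => hGm i, ?_⟩
  have h1 : μ.real (⋃ i ∈ D, symmDiff (W.S^[i] ⁻¹' W.B n) (Φ ⁻¹' G i)) ≤ ε / 2 := by
    refine (measureReal_biUnion_finset_le _ _).trans
      ((Finset.sum_le_sum fun i _ => (hG i).le).trans ?_)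
    rw [Finset.sum_const, nsmul_eq_mul, mul_div_assoc', div_le_div_iff₀ (by positivity) two_pos]
    nlinarith
  refine lt_of_le_of_lt (measureReal_mono fun x hx => ?_)
    (lt_of_le_of_lt (measureReal_union_le (symmDiff A (⋃ i ∈ D, W.S^[i] ⁻¹' W.B n))
      (⋃ i ∈ D, symmDiff (W.S^[i] ⁻¹' W.B n) (Φ ⁻¹' G i))) (by linarith))
  simp only [mem_union, mem_symmDiff, mem_iUnion, mem_preimage, exists_prop] at hx ⊢
  by_cases hxU : ∃ i ∈ D, W.S^[i] x ∈ W.B n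
  · by_cases hxA : x ∈ A
    · obtain ⟨i, hi, hxi⟩ := hxU
      refine Or.inr ⟨i, hi, Or.inl ⟨hxi, fun h => ?_⟩⟩
      rcases hx with hx | hx
      · exact hx.2 ⟨i, hi, h⟩
      · exact hx.2 hxA
    · exact Or.inl (Or.inr ⟨hxU, hxA⟩)
  · by_cases hxA : x ∈ A
    · exact Or.inl (Or.inl ⟨hxA, hxU⟩)
    · rcases hx with hx | ⟨⟨i, hi, h⟩, -⟩
      · exact absurd hx.1 hxA
      · exact Or.inr ⟨i, hi, Or.inr ⟨h, fun h' => hxU ⟨i, hi, h'⟩⟩⟩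

end TowerSystem

/-! ### The residue conditions, odometers and the main theorem -/

namespace RankOneConstruction

variable {X : Type*} [MeasurableSpace X] {μ : Measure X} {T : Transformation μ}
  (R : RankOneConstruction T)

variable {R} in
theorem ResidueCondition.exists_isEigen [IsProbabilityMeasure μ] {l k : ℕ} [NeZero k] {ε : ℝ}
    (h : R.ResidueCondition l ε k) : ∃ f, R.towers.IsEigen k f :=
  TowerSystem.exists_isEigen fun η hη => by
    obtain ⟨N, hN⟩ := h η hη
    exact ⟨N, fun m n hm hmn => (hN m n hm hmn).1⟩

variable {R} in
theorem ResidueCondition.exists_fibre_approx [IsProbabilityMeasure μ] {l k : ℕ} [NeZero k]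
    {ε : ℝ} (hε : 0 < ε) (h : R.ResidueCondition l ε k) {f : X → ZMod k}
    (hf : R.towers.IsEigen k f) :
    ∃ E : Set (ZMod k), μ.completion.real (symmDiff (R.towers.B l) (f ⁻¹' E)) ≤
      2 * ε * R.towers.b l :=
  hf.exists_fibre_approx hε <| by
    -- Condition (IIb) involves neither `η` nor `n`, so any choice of them will do.
    obtain ⟨N, hN⟩ := h 1 one_pos
    exact ⟨N, fun m hm => (hN m (m + 1) hm m.lt_succ_self).2⟩

theorem residueCondition_of_approx [IsProbabilityMeasure μ] {l k : ℕ} [NeZero k] {ε : ℝ}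
    (hε : 0 < ε) {f : X → ZMod k} (hf : R.towers.IsEigen k f) {E : Set (ZMod k)}
    (hE : μ.completion.real (symmDiff (R.towers.B l) (f ⁻¹' E)) < ε / 4 * R.towers.b l) :
    R.ResidueCondition l ε k := fun η hη => by
  obtain ⟨N₁, h₁⟩ := hf.exists_return_residue hη
  obtain ⟨N₂, h₂⟩ := hf.exists_residue_approx hε hE
  exact ⟨max N₁ N₂, fun m n hm hmn =>
    ⟨h₁ m n ((le_max_left _ _).trans hm) hmn, h₂ m ((le_max_right _ _).trans hm)⟩⟩

theorem isEigen_of_intertwines [IsProbabilityMeasure μ] {k : ℕ} {f : X → ZMod k}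
    (hfm : ∀ E, NullMeasurableSet (f ⁻¹' E) μ) (hf : ∀ᵐ x ∂μ, f (T.toFun x) = f x + 1) :
    R.towers.IsEigen k f where
  measurable E _ := hfm E
  map_add_one := by
    have h1 : ∀ᵐ x ∂μ, f (T.invFun x) + 1 = f x := by
      filter_upwards [T.invertible.right_inv, T.invertible.inv_preserving.ae hf] with x h1 h2
      rw [← h2, h1]
    exact h1

theorem exists_residueCondition [IsProbabilityMeasure μ] (O : OdometerSeq)
    (hO : AreIsomorphic μ T.toFun O.measure O.shift) (l : ℕ) {ε : ℝ} (hε : 0 < ε) :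
    ∃ k, 1 < k ∧ R.ResidueCondition l ε k := by
  obtain ⟨φ, ψ, hφψ, hint⟩ := hO
  -- `G` is the base transported to the odometer; a cylinder close to it pulls back to fibres of a
  -- coordinate eigenfunction.
  obtain ⟨G, -, hGm, hG⟩ := (hφψ.inv_preserving.nullMeasurableSet_preimage
    (R.measurable_B l)).exists_measurable_superset_ae_eq
  have hb := R.towers.b_pos l
  obtain ⟨n, E, hE⟩ := O.exists_cylinder_approx hGm (show 0 < ε / 4 * R.towers.b l by positivity)
  refine ⟨O.k n, O.one_lt n, R.residueCondition_of_approx hε (f := fun x => O.coord n (φ x))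
    (E := E) (R.isEigen_of_intertwines ?_ ?_) (lt_of_eq_of_lt ?_ hE)⟩
  · intro E'
    exact (hφψ.map_preserving _ (O.measurable_coord n (show MeasurableSet E' from trivial))).1
  · filter_upwards [hint] with x hx
    rw [hx, O.coord_shift]
  · have h1 : μ (symmDiff (R.B l) ((fun x => O.coord n (φ x)) ⁻¹' E)) =
        O.measure (symmDiff G (O.coord n ⁻¹' E)) := by
      rw [← (hφψ.map_preserving _ (hGm.symmDiff (O.measurable_coord n
        (show MeasurableSet E from trivial)))).2]
      refine measure_congr ?_
      refine Filter.EventuallyEq.symmDiff ?_ Filter.EventuallyEq.rfl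
      filter_upwards [hφψ.left_inv, hφψ.map_preserving.ae hG.mem_iff] with x h2 h3
      apply propext
      change x ∈ R.B l ↔ φ x ∈ G
      rw [h3, mem_preimage, h2]
    exact congrArg ENNReal.toReal h1

/-- The order of every eigenfunction divides the numbers satisfying the residue conditions for
late bases. -/
theorem exists_dvd_of_isEigen [IsProbabilityMeasure μ] {κ : ℕ → ℝ → ℕ}
    (hκ : ∀ l : ℕ, ∀ ε : ℝ, 0 < ε → 1 < κ l ε ∧ R.ResidueCondition l ε (κ l ε)) {a : ℕ} [NeZero a]
    {f : X → ZMod a} (hf : R.towers.IsEigen a f) : ∃ N, ∀ l, N ≤ l → a ∣ κ l (1 / 10) := by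
  obtain ⟨N, hN⟩ := hf.exists_dvd
  refine ⟨N, fun l hl => ?_⟩
  -- With this value the fibre approximation has error `2 * (1 / 10) = 1 / 5`, the threshold in
  -- `IsEigen.exists_dvd`.
  have hpos : (0 : ℝ) < 1 / 10 := by norm_num
  obtain ⟨h1, h2⟩ := hκ l (1 / 10) hpos
  have : NeZero (κ l (1 / 10)) := ⟨by omega⟩
  obtain ⟨g, hg⟩ := h2.exists_isEigen
  obtain ⟨E, hE⟩ := h2.exists_fibre_approx hpos hg
  exact hN l hl _ g E hg (hE.trans (le_of_eq (by ring)))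

theorem exists_lt_order [IsProbabilityMeasure μ] {κ : ℕ → ℝ → ℕ}
    (hκ : ∀ l : ℕ, ∀ ε : ℝ, 0 < ε → 1 < κ l ε ∧ R.ResidueCondition l ε (κ l ε)) (M : ℕ) :
    ∃ l, M < κ l (1 / 10) := by
  obtain ⟨l, hl⟩ := R.towers.exists_b_lt (show (0 : ℝ) < 1 / 2 / (M + 1) by positivity)
  have hl := hl l le_rfl
  refine ⟨l, ?_⟩
  have hpos : (0 : ℝ) < 1 / 10 := by norm_num
  obtain ⟨h1, h2⟩ := hκ l (1 / 10) hpos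
  have : NeZero (κ l (1 / 10)) := ⟨by omega⟩
  obtain ⟨g, hg⟩ := h2.exists_isEigen
  obtain ⟨E, hE⟩ := h2.exists_fibre_approx hpos hg
  have h3 := hg.order_lower_bound (hE.trans (le_of_eq (by ring)))
  have hb := R.towers.b_pos l
  rw [div_le_iff₀ hb] at h3
  rw [lt_div_iff₀ (by positivity)] at hl
  have h4 : (M : ℝ) < κ l (1 / 10) := by
    by_contra! hcon
    nlinarith
  exact_mod_cast h4

/-- A rank-one transformation is isomorphic to an odometer if its bases are approximated by
unions of residue classes modulo divisors of the odometer. -/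
theorem areIsomorphic_of_residueCondition (hμ : IsStandardLebesgue μ) (O : OdometerSeq)
    (hO : ∀ n, ∃ l ε k, 1 < k ∧ R.ResidueCondition l ε k ∧ O.k n ∣ k)
    (hres : ∀ l (ε : ℝ), 0 < ε → ∃ k, R.ResidueCondition l ε k ∧ k ∈ O.divisorSet) :
    AreIsomorphic μ T.toFun O.measure O.shift := by
  have := hμ.isProbabilityMeasure
  obtain ⟨Φ, hΦm, hΦ⟩ := TowerSystem.exists_factor (W := R.towers) O fun n => by
    obtain ⟨l, ε, k, hk, hres, hdvd⟩ := hO n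
    have : NeZero k := ⟨by omega⟩
    obtain ⟨f, hf⟩ := hres.exists_isEigen
    exact ⟨_, hf.cast hdvd⟩
  have hmap : μ.completion.map Φ = O.measure := by
    have := Measure.isProbabilityMeasure_map (μ := μ.completion) hΦm.aemeasurable
    refine O.eq_measure fun n c => ?_
    rw [Measure.map_apply hΦm (O.measurable_coord n (measurableSet_singleton c))]
    have h1 := (hΦ n).real_fibre c
    have h2 : (O.k n : ENNReal)⁻¹ = ENNReal.ofReal (1 / O.k n) := by
      rw [one_div, ENNReal.ofReal_inv_of_pos (by exact_mod_cast O.k_pos n), ENNReal.ofReal_natCast]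
    rw [h2, ← h1, ofReal_measureReal]
    rfl
  have hpres : IsMeasurePreservingMod0 μ O.measure Φ := fun A hA => by
    refine ⟨hΦm hA, ?_⟩
    rw [← hmap, Measure.map_apply hΦm hA]
    rfl
  obtain ⟨ψ, hψ⟩ := exists_isInvertibleMod0 hμ hpres fun A hA ε hε => by
    refine TowerSystem.exists_preimage_approx (W := R.towers) (fun l δ hδ => ?_)
      (MeasurableSet.nullMeasurableSet hA) hε
    have hb := R.towers.b_pos l
    -- The resulting error `2 * ε * b l` is then `δ / 2`, strictly below `δ`.
    have hε' : 0 < δ / (4 * R.towers.b l) := by positivity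
    obtain ⟨k, hk, n, hdvd⟩ := hres l _ hε'
    have : NeZero k := ⟨fun h => (O.k_pos n).ne' (Nat.eq_zero_of_zero_dvd (h ▸ hdvd))⟩
    have hf := (hΦ n).cast hdvd
    obtain ⟨E, hE⟩ := hk.exists_fibre_approx hε' hf
    refine ⟨k, fun y => ZMod.castHom hdvd (ZMod k) (O.coord n y), E,
      (measurable_of_countable _).comp (O.measurable_coord n), hf, hE.trans_lt ?_⟩
    have : 2 * (δ / (4 * R.towers.b l)) * R.towers.b l = δ / 2 := by field_simp; norm_num
    linarith
  refine ⟨Φ, ψ, hψ, ?_⟩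
  have h1 : ∀ᵐ x ∂μ, ∀ n, O.coord n (Φ (T.invFun x)) + 1 = O.coord n (Φ x) :=
    ae_all_iff.2 fun n => (hΦ n).map_add_one
  filter_upwards [T.invertible.left_inv, T.invertible.map_preserving.ae h1] with x h2 h3
  refine O.ext_coord fun n => ?_
  rw [O.coord_shift, ← h3 n, h2]

end RankOneConstruction

theorem mainTheorem2 {X : Type*} [MeasurableSpace X] (μ : Measure X) (hμ : IsStandardLebesgue μ)
    (T : Transformation μ) (R : RankOneConstruction T) :
    ((∃ O : OdometerSeq, AreIsomorphic μ T.toFun O.measure O.shift) ↔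
      ∀ l : ℕ, ∀ ε : ℝ, 0 < ε → ∃ k : ℕ, 1 < k ∧ R.ResidueCondition l ε k) ∧
    ∀ κ : ℕ → ℝ → ℕ,
      (∀ l : ℕ, ∀ ε : ℝ, 0 < ε → 1 < κ l ε ∧ R.ResidueCondition l ε (κ l ε)) →
      ∀ K : Set ℕ, K = {d | ∃ l : ℕ, ∃ ε : ℝ, 0 < ε ∧ d ∣ κ l ε} →
        K.Infinite ∧ (∃ O : OdometerSeq, O.divisorSet = K) ∧
        ∀ O : OdometerSeq, O.divisorSet = K → AreIsomorphic μ T.toFun O.measure O.shift := by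
  have := hμ.isProbabilityMeasure
  have hpos : (0 : ℝ) < 1 / 10 := by norm_num
  have main : ∀ κ : ℕ → ℝ → ℕ,
      (∀ l : ℕ, ∀ ε : ℝ, 0 < ε → 1 < κ l ε ∧ R.ResidueCondition l ε (κ l ε)) →
      ∀ K : Set ℕ, K = {d | ∃ l : ℕ, ∃ ε : ℝ, 0 < ε ∧ d ∣ κ l ε} →
        K.Infinite ∧ (∃ O : OdometerSeq, O.divisorSet = K) ∧
        ∀ O : OdometerSeq, O.divisorSet = K → AreIsomorphic μ T.toFun O.measure O.shift := by
    rintro κ hκ _ rfl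
    have h0 : ∀ a ∈ {d | ∃ l : ℕ, ∃ ε : ℝ, 0 < ε ∧ d ∣ κ l ε}, a ≠ 0 := by
      rintro a ⟨l, ε, hε, hd⟩ rfl
      have := (hκ l ε hε).1
      have := Nat.eq_zero_of_zero_dvd hd
      omega
    -- This makes `K` directed: two elements both divide `κ l (1 / 10)` for one large `l`.
    have hN : ∀ a ∈ {d | ∃ l : ℕ, ∃ ε : ℝ, 0 < ε ∧ d ∣ κ l ε},
        ∃ N, ∀ l, N ≤ l → a ∣ κ l (1 / 10) := by
      intro a ha
      have : NeZero a := ⟨h0 a ha⟩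
      obtain ⟨l, ε, hε, hd⟩ := ha
      have : NeZero (κ l ε) := ⟨by have := (hκ l ε hε).1; omega⟩
      obtain ⟨f, hf⟩ := (hκ l ε hε).2.exists_isEigen
      exact R.exists_dvd_of_isEigen hκ (hf.cast hd)
    refine ⟨infinite_of_forall_exists_gt fun M => ?_, ?_, fun O hO => ?_⟩
    · obtain ⟨l, hl⟩ := R.exists_lt_order hκ M
      exact ⟨_, ⟨l, 1 / 10, hpos, dvd_rfl⟩, hl⟩
    · refine OdometerSeq.exists_divisorSet_eq (fun h => h0 0 h rfl) ?_ ?_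
        ⟨κ 0 1, ⟨0, 1, one_pos, dvd_rfl⟩, (hκ 0 1 one_pos).1⟩
      · rintro a ⟨l, ε, hε, hd⟩ d hda
        exact ⟨l, ε, hε, hda.trans hd⟩
      · intro a ha b hb
        obtain ⟨N₁, h₁⟩ := hN a ha
        obtain ⟨N₂, h₂⟩ := hN b hb
        exact ⟨_, ⟨max N₁ N₂, 1 / 10, hpos, dvd_rfl⟩, h₁ _ (le_max_left _ _),
          h₂ _ (le_max_right _ _)⟩
    · refine R.areIsomorphic_of_residueCondition hμ O (fun n => ?_) fun l ε hε => ?_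
      · have hn : O.k n ∈ O.divisorSet := ⟨n, dvd_rfl⟩
        rw [hO] at hn
        obtain ⟨l, ε, hε, hd⟩ := hn
        exact ⟨l, ε, _, (hκ l ε hε).1, (hκ l ε hε).2, hd⟩
      · refine ⟨κ l ε, (hκ l ε hε).2, ?_⟩
        rw [hO]
        exact ⟨l, ε, hε, dvd_rfl⟩
  refine ⟨⟨?_, fun hII => ?_⟩, main⟩
  · rintro ⟨O, hO⟩ l ε hε
    exact R.exists_residueCondition O hO l hε
  · have hII' : ∀ (l : ℕ) (ε : ℝ), ∃ k, 0 < ε → 1 < k ∧ R.ResidueCondition l ε k := fun l ε => by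
      by_cases hε : 0 < ε
      · obtain ⟨k, hk⟩ := hII l ε hε
        exact ⟨k, fun _ => hk⟩
      · exact ⟨0, fun h => absurd h hε⟩
    choose κ hκ using hII'
    obtain ⟨-, ⟨O, hO⟩, h⟩ := main κ hκ _ rfl
    exact ⟨O, h O hO⟩
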